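/- **Setting.** Slots are $t=1,2,\dots$; there are finitely many targets (flows) $i\in\mathcal I$, satellites $k\in\mathcal K$ and destinations $n\in\mathcal N$. The data are: a slot length $\tau>0$; integers $M_n\ge 0$; a finite nonempty set $\Lambda\subset(0,1]$ of compression ratios; required rates $a_i\in\mathbb R$; and, for each $i$, a utility function $U_i:[0,\infty)\to\mathbb R$ that is increasing, continuously differentiable and strictly concave with $U_i(0)\ge 0$ (for example $U_i(r)=\log(1+r)$). In slot $t$ the channel state is $S(t)=(B_{i,k}(t),C_{k,n}(t))$, with nonnegative entries (an absent link has capacity $0$). The states $S(t)$ are i.i.d. over slots with law $\nu$: there is a filtration $(\mathcal F_t)$ such that $S(t)$ has law $\nu$, is $\mathcal F_{t+1}$-measurable, and is independent of $\mathcal F_t$. **Decisions.** In each slot one chooses $x_{i,k}\in\{0,1\}$ and $\varrho^i_k\in\Lambda$ with $\sum_i x_{i,k}\le 1$ for all $k$ and $\sum_k x_{i,k}\le 1$ for all $i$ (observation constraints), and $y_{k,n}\in\{0,1\}$ and $w_{k,n,i}\ge 0$ with $\sum_n y_{k,n}\le 1$ for all $k$, $\sum_k y_{k,n}\le M_n$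 for all $n$, and $\sum_i w_{k,n,i}\le y_{k,n}C_{k,n}(t)\tau$ for all $k,n$ (transmission constraints). Put $A^i_k=\varrho^i_k x_{i,k}B_{i,k}(t)$, $A_i=\sum_k A^i_k$ and $\mu^i_k=\sum_n y_{k,n}w_{k,n,i}$. A *policy* satisfies these constraints in every slot, and its decisions in slot $t$ are $\mathcal F_{t+1}$-measurable (they depend on the past, on $S(t)$, and possibly on extra randomness independent of future channel states). The data queues are $Q^i_k(1)=0$, $Q^i_k(t+1)=[Q^i_k(t)-\mu^i_k(t)]^++A^i_k(t)$, and the virtual queues are $P_i(t+1)=[P_i(t)+a_i-A_i(t)]^+$ with constants $P_i(1)\ge 0$. **Optimal utility.** Let $U^*$ be the supremum of $\liminf_{T\to\infty}\frac1T\sum_{t=1}^T\sum_i\mathbb E\{U_i(A_i(t))\}$ over all policies such that $\lim_{T\to\infty}\frac1T\mathbb E|Q^i_k(T)|=0$ for all $i,k$ and $\liminf_{T\to\infty}\frac1T\sum_{t=1}^T\mathbb E\{A_i(t)\}\ge a_i$ for all $i$. Assume that at least one such policy exists. **Constants.** Let $\Gamma$ be a finite constant such that, for $\nu$-almost every channel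 state and all decisions satisfying the constraints of one slot, $\Gamma\ge\frac12\sum_{i,k}\{(A^i_k)^2+(\mu^i_k)^2\}+\frac12\sum_i(a_i-A_i)^2$. Say that $\delta_1>0$ is a *slack* if there is a stationary randomized policy (whose decision is a function of the current channel state and an independent random seed) whose arrivals $\widetilde A$ and services $\widetilde\mu$ satisfy $\mathbb E\{\widetilde A^i_k-\widetilde\mu^i_k\}\le-\delta_1$ for all $i,k$ and $\mathbb E\{a_i-\widetilde A_i\}\le 0$ for all $i$. **DMRC algorithm with parameter $V>0$.** In each slot, given $Q(t),P(t),S(t)$, choose $(x,\varrho)$ minimizing $-V\sum_iU_i(A_i)+\sum_{i,k}Q^i_k(t)A^i_k-\sum_iP_i(t)A_i$ subject to the observation constraints, choose $(y,w)$ maximizing $\sum_{i,k}Q^i_k(t)\mu^i_k$ subject to the transmission constraints (ties are broken arbitrarily, by a policy), and then update $Q$ and $P$. **Theorem (DMRC performance bound).** $U^*$ is finite. For every $V>0$, every run of the DMRC algorithm with parameter $V$ has integrable queue lengths $Q^i_k(t)$ and utilities $U_i(A_i(t))$ and satisfies $$\limsup_{T\to\infty}\frac1T\sum_{t=1}^T\sum_{i,k}\mathbb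 E\{Q^i_k(t)\}\le\frac{\Gamma+VU^*}{\delta_1}\qquad\text{for every slack }\delta_1>0,$$ $$\liminf_{T\to\infty}\frac1T\sum_{t=1}^T\sum_i\mathbb E\{U_i(A_i(t))\}\ge U^*-\frac{\Gamma}{V}.$$ Consequently, for every $\varepsilon>0$ there is $V_0>0$ such that for every $V\ge V_0$ the last $\liminf$ is at least $U^*-\varepsilon$ for every run of the DMRC algorithm with parameter $V$. -/

import Mathlib

open MeasureTheory ProbabilityTheory Filter Topology
open scoped NNReal

noncomputable section

namespace SIN

/-- A utility function on data rates in `[0, ∞)`: increasing, continuously differentiable,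
strictly concave, and nonnegative (for an increasing function: nonnegative at rate `0`). -/
structure IsUtility (U : ℝ → ℝ) : Prop where
  monotoneOn : MonotoneOn U (Set.Ici 0)
  contDiffOn : ContDiffOn ℝ 1 U (Set.Ici 0)
  strictConcaveOn : StrictConcaveOn ℝ (Set.Ici 0) U
  nonneg : 0 ≤ U 0

/-- The logarithmic utility `log (1 + r)` is of this kind. -/
theorem isUtility_log : IsUtility (fun r => Real.log (1 + r)) := by
  refine ⟨?_, ?_, ?_, by simp⟩
  · intro x hx y hy h
    simp only [Set.mem_Ici] at hx hy
    exact Real.log_le_log (by linarith) (by linarith)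
  · refine ContDiffOn.log (by fun_prop) ?_
    intro x hx
    simp only [Set.mem_Ici] at hx
    positivity
  · refine ⟨convex_Ici 0, ?_⟩
    intro x hx y hy hxy a b ha hb hab
    simp only [Set.mem_Ici] at hx hy
    have := strictConcaveOn_log_Ioi.2 (x := 1 + x) (y := 1 + y)
      (by simp; linarith) (by simp; linarith) (by simpa using hxy) ha hb hab
    simp only [smul_eq_mul] at this ⊢
    convert this using 2
    linear_combination -hab

/-- The deterministic data of the network, with targets (equivalently flows) `I`, observation
satellites `K` and destinations `N`. -/
structure Network (I K N : Type*) where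
  /-- length of a time slot -/
  τ : ℝ
  τ_pos : 0 < τ
  /-- number of concurrent transmissions that a destination supports -/
  M : N → ℕ
  /-- the finite set `Λ` of available compression ratios
  (compressed volume divided by raw volume) -/
  ratios : Finset ℝ
  ratios_nonempty : ratios.Nonempty
  ratios_pos : ∀ r ∈ ratios, 0 < r
  ratios_le_one : ∀ r ∈ ratios, r ≤ 1
  /-- required long-term average rates -/
  a : I → ℝ
  /-- utility functions of the flows -/
  U : I → ℝ → ℝ
  isUtility : ∀ i, IsUtility (U i)

/-- A channel state: the observation capacities `B i k` and the transmission capacities `C k n`.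
A link that is absent in a slot has capacity `0`. -/
abbrev ChannelState (I K N : Type*) := (I → K → ℝ≥0) × (K → N → ℝ≥0)

/-- The observation scheduling and compression decision of one slot. -/
structure ObsDecision (I K : Type*) where
  /-- `x i k = 1` if satellite `k` observes target `i`, else `0` -/
  x : I → K → ℝ
  /-- compression ratio -/
  ρ : I → K → ℝ

/-- The transmission decision of one slot. -/
structure TxDecision (I K N : Type*) where
  /-- `y k n = 1` if satellite `k` transmits to destination `n`, else `0` -/
  y : K → N → ℝ
  /-- `w k n i` is the data volume allocated to flow `i` on the link from `k` to `n` -/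
  w : K → N → I → ℝ

variable {I K N : Type*} [Fintype I] [Fintype K] [Fintype N]

/-- Constraints on observation scheduling and compression in one slot. -/
structure ObsFeasible (net : Network I K N) (d : ObsDecision I K) : Prop where
  /-- a satellite observes at most one target -/
  sat_le_one : ∀ k, ∑ i, d.x i k ≤ 1
  /-- a target is observed by at most one satellite -/
  target_le_one : ∀ i, ∑ k, d.x i k ≤ 1
  binary : ∀ i k, d.x i k = 0 ∨ d.x i k = 1
  ratio_mem : ∀ i k, d.ρ i k ∈ net.ratios

/-- Constraints on transmission in one slot with transmission capacities `C`. -/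
structure TxFeasible (net : Network I K N) (C : K → N → ℝ≥0) (d : TxDecision I K N) : Prop where
  /-- a satellite transmits to at most one destination -/
  sat_le_one : ∀ k, ∑ n, d.y k n ≤ 1
  /-- destination `n` supports at most `M n` concurrent transmissions -/
  dest_le : ∀ n, ∑ k, d.y k n ≤ net.M n
  binary : ∀ k n, d.y k n = 0 ∨ d.y k n = 1
  volume_nonneg : ∀ k n i, 0 ≤ d.w k n i
  capacity : ∀ k n, ∑ i, d.w k n i ≤ d.y k n * C k n * net.τ

/-- Arrival `A_k^i = ρ x B` to the data queue of flow `i` at satellite `k`. -/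
def arrival (B : I → K → ℝ≥0) (d : ObsDecision I K) (i : I) (k : K) : ℝ :=
  d.ρ i k * d.x i k * B i k

/-- Sum rate `A_i = ∑ k, A_k^i` of flow `i`. -/
def flowRate (B : I → K → ℝ≥0) (d : ObsDecision I K) (i : I) : ℝ :=
  ∑ k, arrival B d i k

/-- Service `μ_k^i = ∑ n, y w` of the data queue of flow `i` at satellite `k`. -/
def service (d : TxDecision I K N) (i : I) (k : K) : ℝ :=
  ∑ n, d.y k n * d.w k n i

section Dynamics

variable {Ω : Type*} [mΩ : MeasurableSpace Ω]

/-- `S t` is the channel state in slot `t` (slots are numbered from `0`), and `ℱ t` is what is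
known before slot `t`. The states are i.i.d. with law `ν`: each `S t` has law `ν` and is
independent of `ℱ t`, which contains the information in `S 0, …, S (t - 1)`. -/
structure IsIIDChannel (μ : Measure Ω) (ℱ : Filtration ℕ mΩ)
    (ν : Measure (ChannelState I K N)) (S : ℕ → Ω → ChannelState I K N) : Prop where
  measurable : ∀ t, Measurable[ℱ (t + 1)] (S t)
  indep : ∀ t, Indep (ℱ t) (MeasurableSpace.comap (S t) inferInstance) μ
  law : ∀ t, μ.map (S t) = ν

/-- A scheduling policy: in each slot the decisions satisfy all one-slot constraints and depend
on nothing but the past, the current channel state and (possibly) a randomization; that is,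
they are `ℱ (t + 1)`-measurable, whereas future channel states are independent
of `ℱ (t + 1)`. -/
structure IsPolicy (net : Network I K N) (ℱ : Filtration ℕ mΩ) (S : ℕ → Ω → ChannelState I K N)
    (o : ℕ → Ω → ObsDecision I K) (u : ℕ → Ω → TxDecision I K N) : Prop where
  measurable_x : ∀ t i k, Measurable[ℱ (t + 1)] fun ω => (o t ω).x i k
  measurable_ρ : ∀ t i k, Measurable[ℱ (t + 1)] fun ω => (o t ω).ρ i k
  measurable_y : ∀ t k n, Measurable[ℱ (t + 1)] fun ω => (u t ω).y k n
  measurable_w : ∀ t k n i, Measurable[ℱ (t + 1)] fun ω => (u t ω).w k n i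
  obsFeasible : ∀ t ω, ObsFeasible net (o t ω)
  txFeasible : ∀ t ω, TxFeasible net (S t ω).2 (u t ω)

/-- Data queues: `Q(t+1) = [Q(t) - μ(t)]⁺ + A(t)`, initially empty. -/
def queue (S : ℕ → Ω → ChannelState I K N) (o : ℕ → Ω → ObsDecision I K)
    (u : ℕ → Ω → TxDecision I K N) : ℕ → Ω → I → K → ℝ
  | 0, _, _, _ => 0
  | t + 1, ω, i, k =>
      max 0 (queue S o u t ω i k - service (u t ω) i k) + arrival (S t ω).1 (o t ω) i k

/-- Virtual queues: `P_i(t+1) = [P_i(t) + a_i - A_i(t)]⁺`, with initial value `P₀`. -/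
def virtualQueue (net : Network I K N) (P₀ : I → ℝ) (S : ℕ → Ω → ChannelState I K N)
    (o : ℕ → Ω → ObsDecision I K) : ℕ → Ω → I → ℝ
  | 0, _, i => P₀ i
  | t + 1, ω, i =>
      max 0 (virtualQueue net P₀ S o t ω i + (net.a i - flowRate (S t ω).1 (o t ω) i))

/-- `(1/T) ∑ f t` over the first `T` slots. -/
def timeAverage (f : ℕ → ℝ) (T : ℕ) : ℝ := (∑ t ∈ Finset.range T, f t) / T

/-- Expected total data queue backlog in slot `t`. -/
def expectedBacklog (μ : Measure Ω) (S : ℕ → Ω → ChannelState I K N)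
    (o : ℕ → Ω → ObsDecision I K) (u : ℕ → Ω → TxDecision I K N) (t : ℕ) : ℝ :=
  ∑ i, ∑ k, ∫ ω, queue S o u t ω i k ∂μ

/-- Expected network utility `∑ i, E[U_i(A_i(t))]` in slot `t`. -/
def expectedUtility (net : Network I K N) (μ : Measure Ω) (S : ℕ → Ω → ChannelState I K N)
    (o : ℕ → Ω → ObsDecision I K) (t : ℕ) : ℝ :=
  ∑ i, ∫ ω, net.U i (flowRate (S t ω).1 (o t ω) i) ∂μ

/-- The long-term constraints: all data queues are mean rate stable, and the long-term average
rate of each flow `i` is at least `a i`. -/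
structure LongTermFeasible (net : Network I K N) (μ : Measure Ω)
    (S : ℕ → Ω → ChannelState I K N) (o : ℕ → Ω → ObsDecision I K)
    (u : ℕ → Ω → TxDecision I K N) : Prop where
  stable : ∀ i k, Tendsto (fun T : ℕ => (∫ ω, |queue S o u T ω i k| ∂μ) / T) atTop (𝓝 0)
  rate : ∀ i, ((net.a i : ℝ) : EReal) ≤ liminf
    (fun T => ((timeAverage (fun t => ∫ ω, flowRate (S t ω).1 (o t ω) i ∂μ) T : ℝ) : EReal)) atTop

/-- The levels `v` such that some policy that satisfies all the constraints of the network utility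
maximization problem has long-term average expected utility at least `v`. -/
def achievableUtilities (net : Network I K N) (μ : Measure Ω) (ℱ : Filtration ℕ mΩ)
    (S : ℕ → Ω → ChannelState I K N) : Set ℝ :=
  {v | ∃ (o : ℕ → Ω → ObsDecision I K) (u : ℕ → Ω → TxDecision I K N),
    IsPolicy net ℱ S o u ∧ LongTermFeasible net μ S o u ∧
    (v : EReal) ≤ liminf
      (fun T => ((timeAverage (expectedUtility net μ S o) T : ℝ) : EReal)) atTop}

/-- The optimal value `U*` of the network utility maximization problem. -/
def optimalUtility (net : Network I K N) (μ : Measure Ω) (ℱ : Filtration ℕ mΩ)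
    (S : ℕ → Ω → ChannelState I K N) : ℝ :=
  sSup (achievableUtilities net μ ℱ S)

/-- Objective (to be minimized) of the joint observation scheduling and adaptive processing
subproblem, for queue lengths `Q`, `P` and observation capacities `B`. -/
def obsObjective (net : Network I K N) (V : ℝ) (Q : I → K → ℝ) (P : I → ℝ)
    (B : I → K → ℝ≥0) (d : ObsDecision I K) : ℝ :=
  -V * ∑ i, net.U i (flowRate B d i) + ∑ i, ∑ k, Q i k * arrival B d i k
    - ∑ i, P i * flowRate B d i

/-- Objective (to be maximized) of the transmission scheduling subproblem. -/
def txObjective (Q : I → K → ℝ) (d : TxDecision I K N) : ℝ :=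
  ∑ i, ∑ k, Q i k * service d i k

/-- The DMRC algorithm with control parameter `V`: in every slot, given the current queues and
channel state, the decisions are solutions of the two subproblems. Ties may be
broken arbitrarily. -/
structure IsDMRC (net : Network I K N) (V : ℝ) (P₀ : I → ℝ) (S : ℕ → Ω → ChannelState I K N)
    (o : ℕ → Ω → ObsDecision I K) (u : ℕ → Ω → TxDecision I K N) : Prop where
  obs_opt : ∀ t ω, ObsFeasible net (o t ω) ∧
    IsMinOn (obsObjective net V (queue S o u t ω) (virtualQueue net P₀ S o t ω) (S t ω).1)
      {d | ObsFeasible net d} (o t ω)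
  tx_opt : ∀ t ω, TxFeasible net (S t ω).2 (u t ω) ∧
    IsMaxOn (txObjective (queue S o u t ω)) {d | TxFeasible net (S t ω).2 d} (u t ω)

end Dynamics

/-- `Γ` bounds the second-order terms of the one-slot Lyapunov drift, for almost every channel
state and all decisions that satisfy the one-slot constraints. -/
def IsDriftConstant (net : Network I K N) (ν : Measure (ChannelState I K N)) (Γ : ℝ) : Prop :=
  ∀ᵐ s ∂ν, ∀ (d : ObsDecision I K) (e : TxDecision I K N),
    ObsFeasible net d → TxFeasible net s.2 e →
    (1 / 2) * ∑ i, ∑ k, (arrival s.1 d i k ^ 2 + service e i k ^ 2)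
      + (1 / 2) * ∑ i, (net.a i - flowRate s.1 d i) ^ 2 ≤ Γ

/-- A stationary randomized policy: the decision is a function of the current channel state and
of an independent random seed with law `seed`, and not of the queues. -/
structure StationaryPolicy (net : Network I K N) where
  seed : Measure ℝ
  isProbabilityMeasure_seed : IsProbabilityMeasure seed
  obs : ℝ × ChannelState I K N → ObsDecision I K
  tx : ℝ × ChannelState I K N → TxDecision I K N
  measurable_x : ∀ i k, Measurable fun z => (obs z).x i k
  measurable_ρ : ∀ i k, Measurable fun z => (obs z).ρ i k
  measurable_y : ∀ k n, Measurable fun z => (tx z).y k n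
  measurable_w : ∀ k n i, Measurable fun z => (tx z).w k n i
  obsFeasible : ∀ z, ObsFeasible net (obs z)
  txFeasible : ∀ z, TxFeasible net z.2.2 (tx z)

/-- Some stationary randomized policy serves every data queue with slack `δ` in expectation,
`E[A_k^i - μ_k^i] ≤ -δ`, and meets all the rate requirements, `E[a_i - A_i] ≤ 0`. -/
def HasSlack (net : Network I K N) (ν : Measure (ChannelState I K N)) (δ : ℝ) : Prop :=
  ∃ π : StationaryPolicy net,
    (∀ i k, ∫ z, (arrival z.2.1 (π.obs z) i k - service (π.tx z) i k) ∂(π.seed.prod ν) ≤ -δ) ∧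
    (∀ i, ∫ z, (net.a i - flowRate z.2.1 (π.obs z) i) ∂(π.seed.prod ν) ≤ 0)

end SIN

end

/-! ### Essentially bounded functions and the drift of one slot. -/

noncomputable section

namespace SIN

/-! The argument is drift plus penalty. Let L be half the sum of the squares of all data and virtual
queues. One slot raises L by at most Γ plus the sum of the terms Q(A - μ) and P(a - A). Subtracting
V times the utility turns these cross terms into the slot objective, which DMRC minimizes for the
current queues and channel state. Let F(q, p) be the expected minimum for frozen queue lengths q, p
and a channel state of law ν (`meanMinObjective`). The queues before slot t are independent of S(t),
so DMRC's expected slot objective is the expectation of F at the current queues. Upper bounds on F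
at fixed nonnegative (q, p) therefore suffice, and there are two.

First, F(q, p) is at most the expected slot objective at (q, p) of any policy in any slot, because
every S(t) has law ν. Average this over a long horizon of a nearly optimal feasible policy: q and p
then multiply average net arrivals and average rate deficits, which are at most a small error. Hence
F ≤ -V U*, without constructing an optimal stationary policy. Summing the drift over T slots and
using L ≥ 0 gives the utility bound.

Second, a slack policy gives F ≤ -δ Σ q, since utilities are nonnegative. The same summation bounds
δ times the average backlog by Γ + V (average utility of DMRC) + o(1).

It remains to see that the average utility of DMRC is eventually at most U* + ε, although U* is a
supremum of lower limits. `Approachable` only asks for good averages over finite horizons, so it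
covers values reached infinitely often. If v is approachable, the first bound holds with v for U*. A
greedy policy then has E L(T) = O(T), so its expected queues are O(√T): it is feasible, and its
lower limit is at least v - Γ/V. Letting V → ∞ gives v ≤ U* (`Approachable.le_optimalUtility`). This
requires a greedy policy with measurable decisions, which comes from minimizing over finitely many
decision rules. -/

/-- Measurable real functions that are bounded almost everywhere. -/
structure EssBdd {X : Type*} [MeasurableSpace X] (m : Measure X) (f : X → ℝ) : Prop where
  measurable : Measurable f
  bdd : ∃ C, ∀ᵐ x ∂m, |f x| ≤ C

namespace EssBdd

variable {X : Type*} [MeasurableSpace X] {m : Measure X} {f g : X → ℝ}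

theorem const (c : ℝ) : EssBdd m fun _ => c :=
  ⟨measurable_const, |c|, .of_forall fun _ => le_rfl⟩

theorem add (hf : EssBdd m f) (hg : EssBdd m g) : EssBdd m fun x => f x + g x := by
  obtain ⟨C, hC⟩ := hf.bdd
  obtain ⟨D, hD⟩ := hg.bdd
  refine ⟨hf.measurable.add hg.measurable, C + D, ?_⟩
  filter_upwards [hC, hD] with x h1 h2
  exact (abs_add_le _ _).trans (add_le_add h1 h2)

theorem mul (hf : EssBdd m f) (hg : EssBdd m g) : EssBdd m fun x => f x * g x := by
  obtain ⟨C, hC⟩ := hf.bdd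
  obtain ⟨D, hD⟩ := hg.bdd
  refine ⟨hf.measurable.mul hg.measurable, C * D, ?_⟩
  filter_upwards [hC, hD] with x h1 h2
  rw [abs_mul]
  exact mul_le_mul h1 h2 (abs_nonneg _) ((abs_nonneg _).trans h1)

theorem const_mul (c : ℝ) (hf : EssBdd m f) : EssBdd m fun x => c * f x := (const c).mul hf

theorem sub (hf : EssBdd m f) (hg : EssBdd m g) : EssBdd m fun x => f x - g x := by
  simpa [sub_eq_add_neg] using hf.add (hg.const_mul (-1))

theorem max_zero (hf : EssBdd m f) : EssBdd m fun x => max 0 (f x) := by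
  obtain ⟨C, hC⟩ := hf.bdd
  refine ⟨measurable_const.max hf.measurable, C, ?_⟩
  filter_upwards [hC] with x h
  rw [abs_of_nonneg (le_max_left _ _)]
  exact max_le ((abs_nonneg _).trans h) ((le_abs_self _).trans h)

theorem sum {ι : Type*} (s : Finset ι) {f : ι → X → ℝ} (hf : ∀ i, EssBdd m (f i)) :
    EssBdd m fun x => ∑ i ∈ s, f i x := by
  classical
  induction s using Finset.induction_on with
  | empty => simpa using const 0
  | insert a s ha ih => simpa [Finset.sum_insert ha] using (hf a).add ih

theorem integrable [IsFiniteMeasure m] (hf : EssBdd m f) : Integrable f m := by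
  obtain ⟨C, hC⟩ := hf.bdd
  exact .of_bound hf.measurable.aestronglyMeasurable C (by simpa using hC)

end EssBdd

theorem IsUtility.nonneg_of_nonneg {U : ℝ → ℝ} (hU : IsUtility U) {r : ℝ} (hr : 0 ≤ r) :
    0 ≤ U r :=
  hU.nonneg.trans (hU.monotoneOn (by simp) hr hr)

theorem IsUtility.measurable_comp {U : ℝ → ℝ} (hU : IsUtility U) {X : Type*}
    [MeasurableSpace X] {f : X → ℝ} (hf : Measurable f) (h0 : ∀ x, 0 ≤ f x) :
    Measurable fun x => U (f x) := by
  -- The utility is controlled on [0, ∞) only. Freezing it at `U 0` on the negatives gives a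
  -- monotone, hence Borel, function.
  have hmono : Monotone fun r => U (max 0 r) := fun r s h =>
    hU.monotoneOn (Set.mem_Ici.2 (le_max_left _ _)) (Set.mem_Ici.2 (le_max_left _ _))
      (max_le_max le_rfl h)
  simpa [Function.comp_def, h0] using hmono.measurable.comp hf

section OneSlot

variable {I K N : Type*} [Fintype I] [Fintype K] {net : Network I K N}

theorem arrival_nonneg {d : ObsDecision I K} (hd : ObsFeasible net d) (B : I → K → ℝ≥0)
    (i : I) (k : K) : 0 ≤ arrival B d i k := by
  have h1 := (net.ratios_pos _ (hd.ratio_mem i k)).le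
  have h2 : 0 ≤ d.x i k := by rcases hd.binary i k with h | h <;> simp [h]
  exact mul_nonneg (mul_nonneg h1 h2) (B i k).2

theorem flowRate_nonneg {d : ObsDecision I K} (hd : ObsFeasible net d) (B : I → K → ℝ≥0)
    (i : I) : 0 ≤ flowRate B d i :=
  Finset.sum_nonneg fun k _ => arrival_nonneg hd B i k

variable [Fintype N]

theorem service_nonneg {C : K → N → ℝ≥0} {e : TxDecision I K N} (he : TxFeasible net C e)
    (i : I) (k : K) : 0 ≤ service e i k := by
  refine Finset.sum_nonneg fun n _ => mul_nonneg ?_ (he.volume_nonneg k n i)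
  rcases he.binary k n with h | h <;> simp [h]

/-- The drift-plus-penalty expression that is minimized in every slot. -/
def slotObjective (net : Network I K N) (V : ℝ) (q : I → K → ℝ) (p : I → ℝ)
    (B : I → K → ℝ≥0) (d : ObsDecision I K) (e : TxDecision I K N) : ℝ :=
  -V * ∑ i, net.U i (flowRate B d i) + ∑ i, ∑ k, q i k * (arrival B d i k - service e i k)
    + ∑ i, p i * (net.a i - flowRate B d i)

/-- Observation and transmission decouple, so solving the two subproblems separately minimizes the
whole expression. -/
theorem slotObjective_eq (net : Network I K N) (V : ℝ) (q : I → K → ℝ) (p : I → ℝ)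
    (B : I → K → ℝ≥0) (d : ObsDecision I K) (e : TxDecision I K N) :
    slotObjective net V q p B d e =
      obsObjective net V q p B d - txObjective q e + ∑ i, p i * net.a i := by
  simp only [slotObjective, obsObjective, txObjective, mul_sub, Finset.sum_sub_distrib]
  ring

/-- The quadratic Lyapunov function of the queues. -/
def lyapunov (q : I → K → ℝ) (p : I → ℝ) : ℝ :=
  (1 / 2) * ∑ i, ∑ k, q i k ^ 2 + (1 / 2) * ∑ i, p i ^ 2

theorem lyapunov_nonneg (q : I → K → ℝ) (p : I → ℝ) : 0 ≤ lyapunov q p := by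
  unfold lyapunov
  positivity

theorem lyapunov_step_le {q A m : I → K → ℝ} {p b : I → ℝ} (hq : ∀ i k, 0 ≤ q i k)
    (hA : ∀ i k, 0 ≤ A i k) (hm : ∀ i k, 0 ≤ m i k) :
    lyapunov (fun i k => max 0 (q i k - m i k) + A i k) (fun i => max 0 (p i + b i)) ≤
      lyapunov q p
        + ((1 / 2) * ∑ i, ∑ k, (A i k ^ 2 + m i k ^ 2) + (1 / 2) * ∑ i, b i ^ 2)
        + (∑ i, ∑ k, q i k * (A i k - m i k) + ∑ i, p i * b i) := by
  have h1 : ∑ i, ∑ k, (max 0 (q i k - m i k) + A i k) ^ 2 ≤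
      ∑ i, ∑ k, (q i k ^ 2 + (A i k ^ 2 + m i k ^ 2) + 2 * (q i k * (A i k - m i k))) := by
    refine Finset.sum_le_sum fun i _ => Finset.sum_le_sum fun k _ => ?_
    have hq := hq i k
    have hA := hA i k
    have hm := hm i k
    rcases max_cases 0 (q i k - m i k) with ⟨h, h'⟩ | ⟨h, h'⟩ <;> rw [h]
    -- If the queue empties, the right side exceeds A² by (q - m)² + 2qA.
    · nlinarith [mul_nonneg hq hA, sq_nonneg (q i k - m i k)]
    -- Otherwise the two sides differ by 2mA.
    · nlinarith [mul_nonneg hm hA]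
  have h2 : ∑ i, (max 0 (p i + b i)) ^ 2 ≤ ∑ i, (p i ^ 2 + b i ^ 2 + 2 * (p i * b i)) := by
    refine Finset.sum_le_sum fun i _ => ?_
    rcases max_cases 0 (p i + b i) with ⟨h, h'⟩ | ⟨h, h'⟩ <;> rw [h]
    · nlinarith [sq_nonneg (p i + b i)]
    · nlinarith
  simp only [Finset.sum_add_distrib, ← Finset.mul_sum] at h1 h2
  simp only [lyapunov, Finset.sum_add_distrib]
  linarith

/-- A measurable choice of feasible decisions for a random channel state `s`. -/
structure IsSlotDecision {X : Type*} [MeasurableSpace X] (net : Network I K N)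
    (s : X → ChannelState I K N) (d : X → ObsDecision I K) (e : X → TxDecision I K N) :
    Prop where
  measurable_state : Measurable s
  measurable_x : ∀ i k, Measurable fun z => (d z).x i k
  measurable_ρ : ∀ i k, Measurable fun z => (d z).ρ i k
  measurable_y : ∀ k n, Measurable fun z => (e z).y k n
  measurable_w : ∀ k n i, Measurable fun z => (e z).w k n i
  obsFeasible : ∀ z, ObsFeasible net (d z)
  txFeasible : ∀ z, TxFeasible net (s z).2 (e z)

namespace IsSlotDecision

variable {X : Type*} {mX : MeasurableSpace X} {s : X → ChannelState I K N}
  {d : X → ObsDecision I K} {e : X → TxDecision I K N}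

theorem measurable_arrival (h : IsSlotDecision net s d e) (i : I) (k : K) :
    Measurable fun z => arrival (s z).1 (d z) i k := by
  have h1 : Measurable fun z => (s z).1 i k :=
    (measurable_pi_iff.1 (measurable_pi_iff.1 h.measurable_state.fst i) k)
  exact ((h.measurable_ρ i k).mul (h.measurable_x i k)).mul h1.coe_nnreal_real

theorem measurable_flowRate (h : IsSlotDecision net s d e) (i : I) :
    Measurable fun z => flowRate (s z).1 (d z) i :=
  Finset.measurable_fun_sum _ fun k _ => h.measurable_arrival i k

theorem measurable_service (h : IsSlotDecision net s d e) (i : I) (k : K) :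
    Measurable fun z => service (e z) i k :=
  Finset.measurable_fun_sum _ fun n _ => (h.measurable_y k n).mul (h.measurable_w k n i)

theorem measurable_utility (h : IsSlotDecision net s d e) (i : I) :
    Measurable fun z => net.U i (flowRate (s z).1 (d z) i) :=
  (net.isUtility i).measurable_comp (h.measurable_flowRate i)
    fun z => flowRate_nonneg (h.obsFeasible z) _ i

variable {ν : Measure (ChannelState I K N)} {Γ : ℝ} {m : Measure X}

theorem ae_drift_le (h : IsSlotDecision net s d e) (hΓ : IsDriftConstant net ν Γ)
    (hs : m.map s = ν) : ∀ᵐ z ∂m,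
      (1 / 2) * ∑ i, ∑ k, (arrival (s z).1 (d z) i k ^ 2 + service (e z) i k ^ 2)
        + (1 / 2) * ∑ i, (net.a i - flowRate (s z).1 (d z) i) ^ 2 ≤ Γ := by
  subst hs
  filter_upwards [ae_of_ae_map h.measurable_state.aemeasurable hΓ] with z hz
  exact hz _ _ (h.obsFeasible z) (h.txFeasible z)

/-- Every square in the drift is nonnegative, so Γ bounds half of each one separately. The constant
Γ is thus the source of all boundedness, and so of integrability. -/
theorem ae_flowRate_le (h : IsSlotDecision net s d e) (hΓ : IsDriftConstant net ν Γ)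
    (hs : m.map s = ν) : ∀ᵐ z ∂m, ∀ i, |net.a i - flowRate (s z).1 (d z) i| ≤ √(2 * Γ) := by
  filter_upwards [h.ae_drift_le hΓ hs] with z hz i
  refine Real.abs_le_sqrt ?_
  have h1 : (0 : ℝ) ≤ ∑ i, ∑ k, (arrival (s z).1 (d z) i k ^ 2 + service (e z) i k ^ 2) := by
    positivity
  have h2 := Finset.single_le_sum (f := fun i => (net.a i - flowRate (s z).1 (d z) i) ^ 2)
    (fun i _ => sq_nonneg _) (Finset.mem_univ i)
  linarith

theorem ae_arrival_service_le (h : IsSlotDecision net s d e) (hΓ : IsDriftConstant net ν Γ)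
    (hs : m.map s = ν) : ∀ᵐ z ∂m, ∀ i k,
      |arrival (s z).1 (d z) i k| ≤ √(2 * Γ) ∧ |service (e z) i k| ≤ √(2 * Γ) := by
  filter_upwards [h.ae_drift_le hΓ hs] with z hz i k
  have h1 : (0 : ℝ) ≤ ∑ i, (net.a i - flowRate (s z).1 (d z) i) ^ 2 := by positivity
  have h2 := Finset.single_le_sum
    (f := fun i => ∑ k, (arrival (s z).1 (d z) i k ^ 2 + service (e z) i k ^ 2))
    (fun i _ => by positivity) (Finset.mem_univ i)
  have h3 := Finset.single_le_sum
    (f := fun k => (arrival (s z).1 (d z) i k ^ 2 + service (e z) i k ^ 2))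
    (fun i _ => by positivity) (Finset.mem_univ k)
  constructor <;> refine Real.abs_le_sqrt ?_ <;>
    nlinarith [sq_nonneg (arrival (s z).1 (d z) i k), sq_nonneg (service (e z) i k)]

theorem essBdd_arrival (h : IsSlotDecision net s d e) (hΓ : IsDriftConstant net ν Γ)
    (hs : m.map s = ν) (i : I) (k : K) : EssBdd m fun z => arrival (s z).1 (d z) i k :=
  ⟨h.measurable_arrival i k, _, (h.ae_arrival_service_le hΓ hs).mono fun _ hz => (hz i k).1⟩

theorem essBdd_service (h : IsSlotDecision net s d e) (hΓ : IsDriftConstant net ν Γ)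
    (hs : m.map s = ν) (i : I) (k : K) : EssBdd m fun z => service (e z) i k :=
  ⟨h.measurable_service i k, _, (h.ae_arrival_service_le hΓ hs).mono fun _ hz => (hz i k).2⟩

theorem essBdd_flowRate (h : IsSlotDecision net s d e) (hΓ : IsDriftConstant net ν Γ)
    (hs : m.map s = ν) (i : I) : EssBdd m fun z => flowRate (s z).1 (d z) i :=
  .sum _ fun k => h.essBdd_arrival hΓ hs i k

theorem ae_utility_le (h : IsSlotDecision net s d e) (hΓ : IsDriftConstant net ν Γ)
    (hs : m.map s = ν) : ∀ᵐ z ∂m, ∀ i,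
      net.U i (flowRate (s z).1 (d z) i) ≤ net.U i (|net.a i| + √(2 * Γ)) := by
  filter_upwards [h.ae_flowRate_le hΓ hs] with z hz i
  refine (net.isUtility i).monotoneOn (flowRate_nonneg (h.obsFeasible z) _ i)
    (Set.mem_Ici.2 (by positivity)) ?_
  linarith [(abs_le.1 (hz i)).1, le_abs_self (net.a i)]

theorem essBdd_utility (h : IsSlotDecision net s d e) (hΓ : IsDriftConstant net ν Γ)
    (hs : m.map s = ν) (i : I) : EssBdd m fun z => net.U i (flowRate (s z).1 (d z) i) := by
  refine ⟨h.measurable_utility i, net.U i (|net.a i| + √(2 * Γ)), ?_⟩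
  filter_upwards [h.ae_utility_le hΓ hs] with z hz
  rw [abs_of_nonneg ((net.isUtility i).nonneg_of_nonneg
    (flowRate_nonneg (h.obsFeasible z) _ i))]
  exact hz i

theorem essBdd_slotObjective (h : IsSlotDecision net s d e) (hΓ : IsDriftConstant net ν Γ)
    (hs : m.map s = ν) (V : ℝ) {q : X → I → K → ℝ} {p : X → I → ℝ}
    (hq : ∀ i k, EssBdd m fun z => q z i k) (hp : ∀ i, EssBdd m fun z => p z i) :
    EssBdd m fun z => slotObjective net V (q z) (p z) (s z).1 (d z) (e z) := by
  refine .add (.add (.const_mul _ (.sum _ fun i => h.essBdd_utility hΓ hs i))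
    (.sum _ fun i => .sum _ fun k => (hq i k).mul ?_)) (.sum _ fun i => (hp i).mul ?_)
  · exact (h.essBdd_arrival hΓ hs i k).sub (h.essBdd_service hΓ hs i k)
  · exact (EssBdd.const _).sub (h.essBdd_flowRate hΓ hs i)

theorem integral_slotObjective [IsFiniteMeasure m] (h : IsSlotDecision net s d e)
    (hΓ : IsDriftConstant net ν Γ) (hs : m.map s = ν) (V : ℝ) (q : I → K → ℝ) (p : I → ℝ) :
    ∫ z, slotObjective net V q p (s z).1 (d z) (e z) ∂m =
      -V * ∑ i, ∫ z, net.U i (flowRate (s z).1 (d z) i) ∂m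
        + ∑ i, ∑ k, q i k * ∫ z, (arrival (s z).1 (d z) i k - service (e z) i k) ∂m
        + ∑ i, p i * ∫ z, (net.a i - flowRate (s z).1 (d z) i) ∂m := by
  have hU := fun i => h.essBdd_utility hΓ hs i
  have hD := fun i k => (h.essBdd_arrival hΓ hs i k).sub (h.essBdd_service hΓ hs i k)
  have hR := fun i => (EssBdd.const (net.a i)).sub (h.essBdd_flowRate hΓ hs i)
  have h1 := (EssBdd.sum Finset.univ hU).const_mul (-V)
  have h2 := EssBdd.sum Finset.univ fun i => EssBdd.sum Finset.univ fun k =>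
    (hD i k).const_mul (q i k)
  have h3 := EssBdd.sum Finset.univ fun i => (hR i).const_mul (p i)
  unfold slotObjective
  rw [integral_add (h1.add h2).integrable h3.integrable,
    integral_add h1.integrable h2.integrable, integral_const_mul,
    integral_finsetSum _ fun i _ => (hU i).integrable,
    integral_finsetSum _ fun i _ => ((hR i).const_mul (p i)).integrable,
    integral_finsetSum _ fun i _ =>
      (EssBdd.sum Finset.univ fun k => (hD i k).const_mul (q i k)).integrable]
  simp only [integral_const_mul]
  congr 2
  refine Finset.sum_congr rfl fun i _ => ?_
  rw [integral_finsetSum _ fun k _ => ((hD i k).const_mul (q i k)).integrable]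
  simp only [integral_const_mul]

end IsSlotDecision

end OneSlot

end SIN

end

/-! ### Finitely many decision rules and measurable minimizers. -/

noncomputable section

namespace SIN

section Template

variable {I K N : Type*} {net : Network I K N}

/-- Finitely many decision rules among which the slot objective attains its minimum: a schedule
and compression ratios, a set of active links, and the flow that each satellite serves. -/
abbrev Template (net : Network I K N) :=
  ((I → K → Bool) × (I → K → net.ratios)) × ((K → N → Bool) × (K → Option I))

/-- The observation decision of a template. -/
def Template.obs (c : Template net) : ObsDecision I K where
  x i k := if c.1.1 i k then 1 else 0
  ρ i k := c.1.2 i k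

open Classical in
/-- The transmission decision of a template: an active link carries the selected flow only. -/
def Template.tx (c : Template net) (C : K → N → ℝ≥0) : TxDecision I K N where
  y k n := if c.2.1 k n then 1 else 0
  w k n i := if c.2.2 k = some i ∧ c.2.1 k n then C k n * net.τ else 0

variable [Fintype I] [Fintype K] [Fintype N]

/-- The templates that satisfy the constraints of one slot. -/
def Template.Feasible (c : Template net) : Prop :=
  ObsFeasible net c.obs ∧ ∀ C, TxFeasible net C (c.tx C)

theorem Template.txFeasible_tx {c : Template net}
    (h1 : ∀ k, ∑ n, (if c.2.1 k n then (1 : ℝ) else 0) ≤ 1)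
    (h2 : ∀ n, ∑ k, (if c.2.1 k n then (1 : ℝ) else 0) ≤ net.M n) (C : K → N → ℝ≥0) :
    TxFeasible net C (c.tx C) where
  sat_le_one := h1
  dest_le := h2
  binary k n := by
    simp only [Template.tx]
    split_ifs <;> simp
  volume_nonneg k n i := by
    have := net.τ_pos
    simp only [Template.tx]
    split_ifs <;> positivity
  capacity k n := by
    have := net.τ_pos
    simp only [Template.tx]
    by_cases hy : c.2.1 k n
    · rcases hf : c.2.2 k with _ | j
      · simp [hy]; positivity
      · refine (Finset.sum_eq_single_of_mem j (Finset.mem_univ j) fun i _ hij => ?_).trans_le ?_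
        · exact if_neg fun h => hij (Option.some_injective _ h.1.symm)
        · simp [hy]
    · simp [hy]

theorem exists_feasible_template (net : Network I K N) : ∃ c : Template net, c.Feasible := by
  obtain ⟨r, hr⟩ := net.ratios_nonempty
  refine ⟨((fun _ _ => false, fun _ _ => ⟨r, hr⟩), (fun _ _ => false, fun _ => none)),
    ⟨?_, ?_, ?_, ?_⟩, Template.txFeasible_tx ?_ ?_⟩ <;> simp [Template.obs, hr]

/-- For fixed active links the transmission objective is linear in the volumes with nonnegative
weights q. It is therefore best to fill each active link with the flow whose queue at the satellite
is longest. That flow does not depend on the destination, so finitely many rules suffice although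
volumes are continuous. -/
theorem exists_template_slotObjective_le (V : ℝ) {q : I → K → ℝ} (hq : ∀ i k, 0 ≤ q i k)
    (p : I → ℝ) {s : ChannelState I K N} {d : ObsDecision I K} {e : TxDecision I K N}
    (hd : ObsFeasible net d) (he : TxFeasible net s.2 e) :
    ∃ c : Template net, c.Feasible ∧
      slotObjective net V q p s.1 c.obs (c.tx s.2) ≤ slotObjective net V q p s.1 d e := by
  classical
  -- The value `none` is used only if there are no flows; quantifying over `i` makes that case
  -- vacuous.
  have hf : ∃ f : K → Option I, ∀ k i, ∃ j, f k = some j ∧ q i k ≤ q j k := by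
    rcases isEmpty_or_nonempty I with hI | hI
    · exact ⟨fun _ => none, fun _ i => isEmptyElim i⟩
    · choose g hg using fun k => Finite.exists_max fun i => q i k
      exact ⟨fun k => some (g k), fun k i => ⟨_, rfl, hg k i⟩⟩
  obtain ⟨f, hf⟩ := hf
  let c : Template net := ((fun i k => decide (d.x i k = 1), fun i k => ⟨d.ρ i k, hd.ratio_mem i k⟩),
    (fun k n => decide (e.y k n = 1), f))
  have hx : ∀ i k, (if d.x i k = 1 then (1 : ℝ) else 0) = d.x i k := fun i k => by
    rcases hd.binary i k with h | h <;> simp [h]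
  have hy : ∀ k n, (if e.y k n = 1 then (1 : ℝ) else 0) = e.y k n := fun k n => by
    rcases he.binary k n with h | h <;> simp [h]
  have hobs : c.obs = d := by simp [c, Template.obs, hx]
  have hcap : ∀ k n i j, f k = some j → q i k ≤ q j k →
      ∑ i, q i k * (e.y k n * e.w k n i) ≤ ∑ i, q i k * ((c.tx s.2).y k n * (c.tx s.2).w k n i) := by
    intro k n i j hj hij
    have hmax : ∀ i, q i k ≤ q j k := fun i => by
      obtain ⟨j', hj', h⟩ := hf k i
      obtain rfl : j = j' := by simpa [hj] using hj'
      exact h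
    rcases he.binary k n with h | h
    · simp [c, Template.tx, h]
    · have h1 := he.capacity k n
      rw [h, one_mul] at h1
      have h2 : ∑ i, q i k * (e.y k n * e.w k n i) ≤ q j k * ∑ i, e.w k n i := by
        rw [Finset.mul_sum]
        refine Finset.sum_le_sum fun i _ => ?_
        rw [h, one_mul]
        exact mul_le_mul_of_nonneg_right (hmax i) (he.volume_nonneg k n i)
      refine h2.trans ((mul_le_mul_of_nonneg_left h1 (hq j k)).trans_eq ?_)
      simp [c, Template.tx, h, hj]
  have htx : txObjective q e ≤ txObjective q (c.tx s.2) := by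
    have key : ∀ e : TxDecision I K N,
        txObjective q e = ∑ k, ∑ n, ∑ i, q i k * (e.y k n * e.w k n i) := fun e => by
      simp only [txObjective, service, Finset.mul_sum]
      rw [Finset.sum_comm]
      exact Finset.sum_congr rfl fun k _ => Finset.sum_comm
    rw [key, key]
    refine Finset.sum_le_sum fun k _ => Finset.sum_le_sum fun n _ => ?_
    rcases isEmpty_or_nonempty I with hI | ⟨⟨i⟩⟩
    · simp
    · obtain ⟨j, hj, hij⟩ := hf k i
      exact hcap k n i j hj hij
  refine ⟨c, ⟨hobs ▸ hd, Template.txFeasible_tx ?_ ?_⟩, ?_⟩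
  · simpa [c, hy] using he.sat_le_one
  · simpa [c, hy] using he.dest_le
  · rw [slotObjective_eq, slotObjective_eq, hobs]
    linarith

theorem isSlotDecision_template {X : Type*} [MeasurableSpace X] {s : X → ChannelState I K N}
    (hs : Measurable s) {σ : X → Template net} (hσ : @Measurable _ _ _ ⊤ σ)
    (hfeas : ∀ z, (σ z).Feasible) :
    IsSlotDecision net s (fun z => (σ z).obs) (fun z => (σ z).tx (s z).2) where
  measurable_state := hs
  measurable_x i k := (@measurable_from_top _ ℝ _ fun c : Template net => c.obs.x i k).comp hσ
  measurable_ρ i k := (@measurable_from_top _ ℝ _ fun c : Template net => c.obs.ρ i k).comp hσ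
  measurable_y k n :=
    (@measurable_from_top _ ℝ _ fun c : Template net => (c.tx 0).y k n).comp hσ
  measurable_w k n i := by
    classical
    let _ : MeasurableSpace (Template net) := ⊤
    have h1 : Measurable fun z => ((s z).2 k n : ℝ) * net.τ :=
      ((measurable_pi_iff.1 (measurable_pi_iff.1 hs.snd k) n).coe_nnreal_real).mul_const _
    have h2 : MeasurableSet {z | (σ z).2.2 k = some i ∧ (σ z).2.1 k n} :=
      hσ (MeasurableSpace.measurableSet_top
        (s := {c : Template net | c.2.2 k = some i ∧ c.2.1 k n}))
    exact Measurable.ite h2 h1 measurable_const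
  obsFeasible z := (hfeas z).1
  txFeasible z := (hfeas z).2 _

theorem measurable_slotObjective {X : Type*} [MeasurableSpace X] {s : X → ChannelState I K N}
    {d : X → ObsDecision I K} {e : X → TxDecision I K N} (h : IsSlotDecision net s d e) (V : ℝ)
    {q : X → I → K → ℝ} {p : X → I → ℝ} (hq : Measurable q) (hp : Measurable p) :
    Measurable fun z => slotObjective net V (q z) (p z) (s z).1 (d z) (e z) := by
  have hq' : ∀ i k, Measurable fun z => q z i k := fun i k =>
    measurable_pi_iff.1 (measurable_pi_iff.1 hq i) k
  have hp' : ∀ i, Measurable fun z => p z i := measurable_pi_iff.1 hp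
  refine .add (.add (.const_mul (Finset.measurable_fun_sum _ fun i _ => h.measurable_utility i) _)
    (Finset.measurable_fun_sum _ fun i _ => Finset.measurable_fun_sum _ fun k _ =>
      (hq' i k).mul ((h.measurable_arrival i k).sub (h.measurable_service i k))))
    (Finset.measurable_fun_sum _ fun i _ =>
      (hp' i).mul (measurable_const.sub (h.measurable_flowRate i)))

/-- Induction on the finite set: switch to the new candidate on the measurable set where it does at
least as well as the minimizer found so far. -/
theorem exists_measurable_argmin {X T : Type*} [MeasurableSpace X] [MeasurableSpace T]
    [DiscreteMeasurableSpace T] [Countable T] {s : Finset T} (hs : s.Nonempty) {f : T → X → ℝ}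
    (hf : ∀ t, Measurable (f t)) :
    ∃ σ : X → T, Measurable σ ∧ ∀ x, σ x ∈ s ∧ ∀ t ∈ s, f (σ x) x ≤ f t x := by
  classical
  induction hs using Finset.Nonempty.cons_induction with
  | singleton a => exact ⟨fun _ => a, measurable_const, by simp⟩
  | cons a s ha hs ih =>
    obtain ⟨σ, hσ, h⟩ := ih
    have hm : Measurable fun x => f (σ x) x :=
      (measurable_from_prod_countable_right (f := fun z : T × X => f z.1 z.2) hf).comp
        (hσ.prodMk measurable_id)
    refine ⟨fun x => if f a x ≤ f (σ x) x then a else σ x,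
      .ite (measurableSet_le (hf a) hm) measurable_const hσ, fun x => ?_⟩
    obtain ⟨h1, h2⟩ := h x
    by_cases hx : f a x ≤ f (σ x) x
    · simp only [hx, if_true, Finset.mem_cons, true_or, true_and, forall_eq_or_imp, le_refl]
      exact fun t ht => hx.trans (h2 t ht)
    · simp only [hx, if_false, Finset.mem_cons, h1, or_true, true_and, forall_eq_or_imp]
      exact ⟨(not_le.1 hx).le, h2⟩

/-- The queue lengths together with the channel state at the beginning of a slot. -/
abbrev SlotState (I K N : Type*) := ((I → K → ℝ) × (I → ℝ)) × ChannelState I K N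

theorem exists_selector (net : Network I K N) (V : ℝ) :
    ∃ σ : SlotState I K N → Template net, @Measurable _ _ _ ⊤ σ ∧ ∀ z, (σ z).Feasible ∧
      ∀ c : Template net, c.Feasible →
        slotObjective net V z.1.1 z.1.2 z.2.1 (σ z).obs ((σ z).tx z.2.2) ≤
          slotObjective net V z.1.1 z.1.2 z.2.1 c.obs (c.tx z.2.2) := by
  classical
  let _ : MeasurableSpace (Template net) := ⊤
  have : DiscreteMeasurableSpace (Template net) := ⟨fun _ => trivial⟩
  have : Fintype (Template net) := Fintype.ofFinite _
  obtain ⟨c₀, hc₀⟩ := exists_feasible_template net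
  obtain ⟨σ, hσ, h⟩ := exists_measurable_argmin (X := SlotState I K N)
    (s := {c : Template net | c.Feasible}.toFinset) ⟨c₀, Set.mem_toFinset.2 hc₀⟩
    -- Infeasible templates get the dummy value 0: measurability is known for feasible ones only,
    -- and the minimum is over these.
    (f := fun c z => if c.Feasible then
      slotObjective net V z.1.1 z.1.2 z.2.1 c.obs (c.tx z.2.2) else 0)
    (fun c => by
      by_cases hc : c.Feasible
      · simp only [hc, if_true]
        exact measurable_slotObjective (isSlotDecision_template measurable_snd
          (measurable_const (a := c)) fun _ => hc) V measurable_fst.fst measurable_fst.snd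
      · simp only [hc, if_false]
        exact measurable_const)
  refine ⟨σ, hσ, fun z => ?_⟩
  obtain ⟨h1, h2⟩ := h z
  have h1' : (σ z).Feasible := (Set.mem_toFinset (s := {c : Template net | c.Feasible})).1 h1
  refine ⟨h1', fun c hc => ?_⟩
  have h3 := h2 c (Set.mem_toFinset.2 hc)
  rwa [if_pos h1', if_pos hc] at h3

/-- A measurable minimizer of the slot objective. -/
def selector (net : Network I K N) (V : ℝ) : SlotState I K N → Template net :=
  (exists_selector net V).choose

theorem measurable_selector (net : Network I K N) (V : ℝ) :
    @Measurable _ _ _ ⊤ (selector net V) := (exists_selector net V).choose_spec.1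

theorem selector_feasible (net : Network I K N) (V : ℝ) (z : SlotState I K N) :
    (selector net V z).Feasible := ((exists_selector net V).choose_spec.2 z).1

/-- The minimal value of the slot objective. -/
def minObjective (net : Network I K N) (V : ℝ) (z : SlotState I K N) : ℝ :=
  slotObjective net V z.1.1 z.1.2 z.2.1 (selector net V z).obs ((selector net V z).tx z.2.2)

theorem minObjective_le (V : ℝ) {z : SlotState I K N} (hq : ∀ i k, 0 ≤ z.1.1 i k)
    {d : ObsDecision I K} {e : TxDecision I K N} (hd : ObsFeasible net d)
    (he : TxFeasible net z.2.2 e) :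
    minObjective net V z ≤ slotObjective net V z.1.1 z.1.2 z.2.1 d e := by
  obtain ⟨c, hc, h⟩ := exists_template_slotObjective_le V hq z.1.2 hd he
  exact (((exists_selector net V).choose_spec.2 z).2 c hc).trans h

theorem isSlotDecision_selector (net : Network I K N) (V : ℝ) {X : Type*} [MeasurableSpace X]
    {f : X → SlotState I K N} (hf : Measurable f) :
    IsSlotDecision net (fun x => (f x).2) (fun x => (selector net V (f x)).obs)
      (fun x => (selector net V (f x)).tx (f x).2.2) :=
  isSlotDecision_template hf.snd ((measurable_selector net V).comp hf)
    fun _ => selector_feasible net V _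

theorem measurable_minObjective (net : Network I K N) (V : ℝ) :
    Measurable (minObjective net V) :=
  measurable_slotObjective (isSlotDecision_selector net V measurable_id) V
    measurable_fst.fst measurable_fst.snd

/-- The expected minimal value of the slot objective for given queue lengths. -/
def meanMinObjective (net : Network I K N) (ν : Measure (ChannelState I K N)) (V : ℝ)
    (q : I → K → ℝ) (p : I → ℝ) : ℝ :=
  ∫ s, minObjective net V ((q, p), s) ∂ν

/-- Since q and p are constants, the pointwise minimum can be integrated against any decision. The
decision may depend on the past; only the law of the state matters. -/
theorem meanMinObjective_le {ν : Measure (ChannelState I K N)} {Γ : ℝ}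
    (hΓ : IsDriftConstant net ν Γ) {X : Type*} [MeasurableSpace X] {m : Measure X}
    [IsFiniteMeasure m] {s : X → ChannelState I K N} {d : X → ObsDecision I K}
    {e : X → TxDecision I K N} (h : IsSlotDecision net s d e) (hs : m.map s = ν) (V : ℝ)
    {q : I → K → ℝ} (hq : ∀ i k, 0 ≤ q i k) (p : I → ℝ) :
    meanMinObjective net ν V q p ≤
      -V * ∑ i, ∫ z, net.U i (flowRate (s z).1 (d z) i) ∂m
        + ∑ i, ∑ k, q i k * ∫ z, (arrival (s z).1 (d z) i k - service (e z) i k) ∂m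
        + ∑ i, p i * ∫ z, (net.a i - flowRate (s z).1 (d z) i) ∂m := by
  have hms := h.measurable_state
  have hf : Measurable fun x => (((q, p), s x) : SlotState I K N) :=
    measurable_const.prodMk hms
  rw [← h.integral_slotObjective hΓ hs V q p, meanMinObjective, ← hs,
    integral_map (f := fun s => minObjective net V ((q, p), s)) hms.aemeasurable
      ((measurable_minObjective net V).comp measurable_prodMk_left).aestronglyMeasurable]
  refine integral_mono ?_ ?_ fun x =>
    minObjective_le (z := ((q, p), s x)) V hq (h.obsFeasible x) (h.txFeasible x)
  · exact ((isSlotDecision_selector net V hf).essBdd_slotObjective hΓ hs V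
      (fun i k => .const (q i k)) fun i => .const (p i)).integrable
  · exact (h.essBdd_slotObjective hΓ hs V
      (fun i k => .const (q i k)) fun i => .const (p i)).integrable

end Template

end SIN

end

/-! ### Policies, time averages and approachable utilities. -/

noncomputable section

namespace SIN

set_option linter.unusedSectionVars false

section Policies

variable {I K N : Type*} [Fintype I] [Fintype K] [Fintype N] {net : Network I K N}
  {Ω : Type*} [mΩ : MeasurableSpace Ω] {μ : Measure Ω} {ℱ : Filtration ℕ mΩ}
  {ν : Measure (ChannelState I K N)} {S : ℕ → Ω → ChannelState I K N}
  {o : ℕ → Ω → ObsDecision I K} {u : ℕ → Ω → TxDecision I K N} {P₀ : I → ℝ} {Γ V : ℝ}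

theorem IsIIDChannel.isProbabilityMeasure [IsProbabilityMeasure μ] (hS : IsIIDChannel μ ℱ ν S) :
    IsProbabilityMeasure ν := by
  rw [← hS.law 0]
  exact Measure.isProbabilityMeasure_map ((hS.measurable 0).mono (ℱ.le _) le_rfl).aemeasurable

/-- Working with `ℱ (t + 1)` instead of the ambient σ-algebra makes the queues adapted, which later
yields independence from the current state. -/
theorem IsPolicy.isSlotDecision_filtration (hp : IsPolicy net ℱ S o u)
    (hS : IsIIDChannel μ ℱ ν S) (t : ℕ) :
    @IsSlotDecision I K N _ _ _ Ω (ℱ (t + 1)) net (S t) (o t) (u t) :=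
  @IsSlotDecision.mk I K N _ _ _ Ω (ℱ (t + 1)) net (S t) (o t) (u t) (hS.measurable t)
    (hp.measurable_x t) (hp.measurable_ρ t) (hp.measurable_y t) (hp.measurable_w t)
    (hp.obsFeasible t) (hp.txFeasible t)

theorem IsPolicy.isSlotDecision (hp : IsPolicy net ℱ S o u) (hS : IsIIDChannel μ ℱ ν S)
    (t : ℕ) : IsSlotDecision net (S t) (o t) (u t) where
  measurable_state := (hS.measurable t).mono (ℱ.le _) le_rfl
  measurable_x i k := (hp.measurable_x t i k).mono (ℱ.le _) le_rfl
  measurable_ρ i k := (hp.measurable_ρ t i k).mono (ℱ.le _) le_rfl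
  measurable_y k n := (hp.measurable_y t k n).mono (ℱ.le _) le_rfl
  measurable_w k n i := (hp.measurable_w t k n i).mono (ℱ.le _) le_rfl
  obsFeasible := hp.obsFeasible t
  txFeasible := hp.txFeasible t

theorem measurable_queue (hp : IsPolicy net ℱ S o u) (hS : IsIIDChannel μ ℱ ν S) (t : ℕ)
    (i : I) (k : K) : Measurable[ℱ t] fun ω => queue S o u t ω i k := by
  induction t with
  | zero => exact measurable_const
  | succ t ih =>
    have h := hp.isSlotDecision_filtration hS t
    have ih' := ih.mono (ℱ.mono t.le_succ) le_rfl
    exact (measurable_const.max (ih'.sub (h.measurable_service i k))).add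
      (h.measurable_arrival i k)

theorem measurable_virtualQueue (hp : IsPolicy net ℱ S o u) (hS : IsIIDChannel μ ℱ ν S)
    (P₀ : I → ℝ) (t : ℕ) (i : I) :
    Measurable[ℱ t] fun ω => virtualQueue net P₀ S o t ω i := by
  induction t with
  | zero => exact measurable_const
  | succ t ih =>
    have h := hp.isSlotDecision_filtration hS t
    have ih' := ih.mono (ℱ.mono t.le_succ) le_rfl
    exact measurable_const.max (ih'.add (measurable_const.sub (h.measurable_flowRate i)))

theorem essBdd_queue (hp : IsPolicy net ℱ S o u) (hS : IsIIDChannel μ ℱ ν S)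
    (hΓ : IsDriftConstant net ν Γ) (t : ℕ) (i : I) (k : K) :
    EssBdd μ fun ω => queue S o u t ω i k := by
  induction t with
  | zero => exact .const 0
  | succ t ih =>
    have h := hp.isSlotDecision hS t
    exact (ih.sub (h.essBdd_service hΓ (hS.law t) i k)).max_zero.add
      (h.essBdd_arrival hΓ (hS.law t) i k)

theorem essBdd_virtualQueue (hp : IsPolicy net ℱ S o u) (hS : IsIIDChannel μ ℱ ν S)
    (hΓ : IsDriftConstant net ν Γ) (P₀ : I → ℝ) (t : ℕ) (i : I) :
    EssBdd μ fun ω => virtualQueue net P₀ S o t ω i := by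
  induction t with
  | zero => exact .const (P₀ i)
  | succ t ih =>
    have h := hp.isSlotDecision hS t
    exact (ih.add ((EssBdd.const _).sub (h.essBdd_flowRate hΓ (hS.law t) i))).max_zero

theorem queue_nonneg (hp : IsPolicy net ℱ S o u) (t : ℕ) (ω : Ω) (i : I) (k : K) :
    0 ≤ queue S o u t ω i k := by
  cases t with
  | zero => exact le_rfl
  | succ t => exact add_nonneg (le_max_left _ _) (arrival_nonneg (hp.obsFeasible t ω) _ i k)

theorem virtualQueue_nonneg (hP₀ : ∀ i, 0 ≤ P₀ i) (t : ℕ) (ω : Ω) (i : I) :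
    0 ≤ virtualQueue net P₀ S o t ω i := by
  cases t with
  | zero => exact hP₀ i
  | succ t => exact le_max_left _ _

/-- Dropping the positive part can only lower the queue, and the remaining recursion telescopes. -/
theorem sum_le_queue (S : ℕ → Ω → ChannelState I K N) (o : ℕ → Ω → ObsDecision I K)
    (u : ℕ → Ω → TxDecision I K N) (T : ℕ) (ω : Ω) (i : I) (k : K) :
    ∑ t ∈ Finset.range T, (arrival (S t ω).1 (o t ω) i k - service (u t ω) i k) ≤
      queue S o u T ω i k := by
  induction T with
  | zero => simp [queue]
  | succ T ih =>
    rw [Finset.sum_range_succ, queue]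
    linarith [le_max_right 0 (queue S o u T ω i k - service (u T ω) i k)]

theorem sum_le_virtualQueue (hP₀ : ∀ i, 0 ≤ P₀ i) (S : ℕ → Ω → ChannelState I K N)
    (o : ℕ → Ω → ObsDecision I K) (T : ℕ) (ω : Ω) (i : I) :
    ∑ t ∈ Finset.range T, (net.a i - flowRate (S t ω).1 (o t ω) i) ≤
      virtualQueue net P₀ S o T ω i := by
  induction T with
  | zero => simpa [virtualQueue] using hP₀ i
  | succ T ih =>
    rw [Finset.sum_range_succ, virtualQueue]
    linarith [le_max_right 0
      (virtualQueue net P₀ S o T ω i + (net.a i - flowRate (S T ω).1 (o T ω) i))]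

/-- Expected net arrival to a data queue in slot `t`. -/
def expectedDrift (μ : Measure Ω) (S : ℕ → Ω → ChannelState I K N)
    (o : ℕ → Ω → ObsDecision I K) (u : ℕ → Ω → TxDecision I K N) (i : I) (k : K) (t : ℕ) : ℝ :=
  ∫ ω, (arrival (S t ω).1 (o t ω) i k - service (u t ω) i k) ∂μ

/-- Expected rate deficit of a flow in slot `t`. -/
def expectedDeficit (net : Network I K N) (μ : Measure Ω) (S : ℕ → Ω → ChannelState I K N)
    (o : ℕ → Ω → ObsDecision I K) (i : I) (t : ℕ) : ℝ :=
  ∫ ω, (net.a i - flowRate (S t ω).1 (o t ω) i) ∂μ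

variable [IsProbabilityMeasure μ]

theorem timeAverage_drift_le (hp : IsPolicy net ℱ S o u) (hS : IsIIDChannel μ ℱ ν S)
    (hΓ : IsDriftConstant net ν Γ) (i : I) (k : K) (T : ℕ) :
    timeAverage (expectedDrift μ S o u i k) T ≤ (∫ ω, queue S o u T ω i k ∂μ) / T := by
  have h := fun t => (((hp.isSlotDecision hS t).essBdd_arrival hΓ (hS.law t) i k).sub
    ((hp.isSlotDecision hS t).essBdd_service hΓ (hS.law t) i k))
  unfold timeAverage expectedDrift
  rw [← integral_finsetSum _ fun t _ => (h t).integrable]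
  refine div_le_div_of_nonneg_right ?_ T.cast_nonneg
  exact integral_mono (EssBdd.sum _ h).integrable (essBdd_queue hp hS hΓ T i k).integrable
    fun ω => sum_le_queue S o u T ω i k

theorem timeAverage_deficit_le (hp : IsPolicy net ℱ S o u) (hS : IsIIDChannel μ ℱ ν S)
    (hΓ : IsDriftConstant net ν Γ) (hP₀ : ∀ i, 0 ≤ P₀ i) (i : I) (T : ℕ) :
    timeAverage (expectedDeficit net μ S o i) T ≤
      (∫ ω, virtualQueue net P₀ S o T ω i ∂μ) / T := by
  have h := fun t => ((EssBdd.const (net.a i)).sub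
    ((hp.isSlotDecision hS t).essBdd_flowRate hΓ (hS.law t) i))
  unfold timeAverage expectedDeficit
  rw [← integral_finsetSum _ fun t _ => (h t).integrable]
  refine div_le_div_of_nonneg_right ?_ T.cast_nonneg
  exact integral_mono (EssBdd.sum _ h).integrable
    (essBdd_virtualQueue hp hS hΓ P₀ T i).integrable fun ω => sum_le_virtualQueue hP₀ S o T ω i

theorem timeAverage_deficit (hp : IsPolicy net ℱ S o u) (hS : IsIIDChannel μ ℱ ν S)
    (hΓ : IsDriftConstant net ν Γ) (i : I) {T : ℕ} (hT : 0 < T) :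
    timeAverage (expectedDeficit net μ S o i) T =
      net.a i - timeAverage (fun t => ∫ ω, flowRate (S t ω).1 (o t ω) i ∂μ) T := by
  have h : ∀ t, expectedDeficit net μ S o i t =
      net.a i - ∫ ω, flowRate (S t ω).1 (o t ω) i ∂μ := fun t => by
    rw [expectedDeficit, integral_sub (integrable_const _)
      ((hp.isSlotDecision hS t).essBdd_flowRate hΓ (hS.law t) i).integrable]
    simp
  have hT' : (T : ℝ) ≠ 0 := by positivity
  simp only [timeAverage, h, Finset.sum_sub_distrib, Finset.sum_const, Finset.card_range,
    nsmul_eq_mul]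
  field_simp

theorem expectedUtility_le (hp : IsPolicy net ℱ S o u) (hS : IsIIDChannel μ ℱ ν S)
    (hΓ : IsDriftConstant net ν Γ) (t : ℕ) :
    expectedUtility net μ S o t ≤ ∑ i, net.U i (|net.a i| + √(2 * Γ)) := by
  refine Finset.sum_le_sum fun i _ => ?_
  have h := hp.isSlotDecision hS t
  refine (integral_mono_ae (h.essBdd_utility hΓ (hS.law t) i).integrable
    (integrable_const (net.U i (|net.a i| + √(2 * Γ)))) ?_).trans_eq (by simp)
  exact (h.ae_utility_le hΓ (hS.law t)).mono fun ω hω => hω i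

theorem le_liminf_coe {f : ℕ → ℝ} {c : ℝ} (h : ∀ ε > 0, ∀ᶠ T in atTop, c - ε ≤ f T) :
    (c : EReal) ≤ liminf (fun T => (f T : EReal)) atTop := by
  refine EReal.ge_of_forall_gt_iff_ge.1 fun z hz => ?_
  refine le_liminf_of_le (by isBoundedDefault) ?_
  filter_upwards [h (c - z) (sub_pos.2 (EReal.coe_lt_coe_iff.1 hz))] with T hT
  exact EReal.coe_le_coe_iff.2 (by linarith)

theorem limsup_coe_le {f : ℕ → ℝ} {c : ℝ} (h : ∀ ε > 0, ∀ᶠ T in atTop, f T ≤ c + ε) :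
    limsup (fun T => (f T : EReal)) atTop ≤ (c : EReal) := by
  refine EReal.le_of_forall_lt_iff_le.1 fun z hz => ?_
  refine limsup_le_of_le (by isBoundedDefault) ?_
  filter_upwards [h (z - c) (sub_pos.2 (EReal.coe_lt_coe_iff.1 hz))] with T hT
  exact EReal.coe_le_coe_iff.2 (by linarith)

theorem eventually_sub_le_of_le_liminf {f : ℕ → ℝ} {c : ℝ}
    (h : (c : EReal) ≤ liminf (fun T => (f T : EReal)) atTop) {ε : ℝ} (hε : 0 < ε) :
    ∀ᶠ T in atTop, c - ε ≤ f T := by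
  have h1 : ((c - ε : ℝ) : EReal) < liminf (fun T => (f T : EReal)) atTop :=
    (EReal.coe_lt_coe_iff.2 (by linarith)).trans_le h
  filter_upwards [eventually_lt_of_lt_liminf h1] with T hT
  exact (EReal.coe_lt_coe_iff.1 hT).le

theorem timeAverage_le {f : ℕ → ℝ} {c : ℝ} (hf : ∀ t, f t ≤ c) {T : ℕ} (hT : 0 < T) :
    timeAverage f T ≤ c := by
  have hT' : (0 : ℝ) < T := by exact_mod_cast hT
  rw [timeAverage, div_le_iff₀ hT']
  simpa [mul_comm] using Finset.sum_le_sum fun t (_ : t ∈ Finset.range T) => hf t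

theorem bddAbove_achievableUtilities (hS : IsIIDChannel μ ℱ ν S)
    (hΓ : IsDriftConstant net ν Γ) : BddAbove (achievableUtilities net μ ℱ S) := by
  refine ⟨∑ i, net.U i (|net.a i| + √(2 * Γ)), ?_⟩
  rintro v ⟨o, u, hp, -, hv⟩
  refine le_of_forall_pos_le_add fun ε hε => ?_
  obtain ⟨T, h1, h2⟩ :=
    ((eventually_sub_le_of_le_liminf hv hε).and (eventually_gt_atTop 0)).exists
  linarith [timeAverage_le (expectedUtility_le hp hS hΓ) h2]

/-- Accumulated net arrivals are dominated by the queue, so mean rate stability controls their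
average; the rate constraint controls the deficit. -/
theorem LongTermFeasible.eventually_le (h : LongTermFeasible net μ S o u)
    (hp : IsPolicy net ℱ S o u) (hS : IsIIDChannel μ ℱ ν S) (hΓ : IsDriftConstant net ν Γ)
    {ε : ℝ} (hε : 0 < ε) : ∀ᶠ T in atTop,
      (∀ i k, timeAverage (expectedDrift μ S o u i k) T ≤ ε) ∧
      (∀ i, timeAverage (expectedDeficit net μ S o i) T ≤ ε) := by
  refine .and (eventually_all.2 fun i => eventually_all.2 fun k => ?_)
    (eventually_all.2 fun i => ?_)
  · filter_upwards [(h.stable i k).eventually_lt_const hε] with T hT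
    refine (timeAverage_drift_le hp hS hΓ i k T).trans ?_
    simpa only [abs_of_nonneg (queue_nonneg hp _ _ i k)] using hT.le
  · filter_upwards [eventually_sub_le_of_le_liminf (h.rate i) hε, eventually_gt_atTop 0]
      with T hT hT'
    rw [timeAverage_deficit hp hS hΓ i hT']
    linarith

/-- Over suitable finite horizons, policies have average utility at least `v` and meet the
long-term constraints, both up to arbitrarily small errors. -/
def Approachable (net : Network I K N) (μ : Measure Ω) (ℱ : Filtration ℕ mΩ)
    (S : ℕ → Ω → ChannelState I K N) (v : ℝ) : Prop :=
  ∀ ε > 0, ∃ o u, IsPolicy net ℱ S o u ∧ ∃ T : ℕ, 0 < T ∧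
    v - ε ≤ timeAverage (expectedUtility net μ S o) T ∧
    (∀ i k, timeAverage (expectedDrift μ S o u i k) T ≤ ε) ∧
    (∀ i, timeAverage (expectedDeficit net μ S o i) T ≤ ε)

/-- The long-term constraints hold at all large horizons, so it is enough that the utility is good
at infinitely many of them. -/
theorem LongTermFeasible.approachable (h : LongTermFeasible net μ S o u)
    (hp : IsPolicy net ℱ S o u) (hS : IsIIDChannel μ ℱ ν S) (hΓ : IsDriftConstant net ν Γ)
    {v : ℝ} (hv : ∃ᶠ T in atTop, v ≤ timeAverage (expectedUtility net μ S o) T) :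
    Approachable net μ ℱ S v := by
  intro ε hε
  obtain ⟨T, hT, ⟨h1, h2⟩, h3⟩ :=
    (hv.and_eventually ((h.eventually_le hp hS hΓ hε).and (eventually_gt_atTop 0))).exists
  exact ⟨o, u, hp, T, h3, by linarith, h1, h2⟩

theorem meanMinObjective_le_timeAverage (hp : IsPolicy net ℱ S o u) (hS : IsIIDChannel μ ℱ ν S)
    (hΓ : IsDriftConstant net ν Γ) (V : ℝ) {q : I → K → ℝ} (hq : ∀ i k, 0 ≤ q i k) (p : I → ℝ)
    {T : ℕ} (hT : 0 < T) :
    meanMinObjective net ν V q p ≤ -V * timeAverage (expectedUtility net μ S o) T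
      + ∑ i, ∑ k, q i k * timeAverage (expectedDrift μ S o u i k) T
      + ∑ i, p i * timeAverage (expectedDeficit net μ S o i) T := by
  have hT' : (0 : ℝ) < T := by exact_mod_cast hT
  have h := Finset.sum_le_sum fun t (_ : t ∈ Finset.range T) =>
    meanMinObjective_le hΓ (hp.isSlotDecision hS t) (hS.law t) V hq p
  rw [Finset.sum_const, Finset.card_range, nsmul_eq_mul, mul_comm, ← le_div_iff₀ hT'] at h
  refine h.trans_eq ?_
  simp only [Finset.sum_add_distrib, add_div, timeAverage, expectedUtility, expectedDrift,
    expectedDeficit, ← Finset.mul_sum, mul_div_assoc]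
  congr 2
  · rw [Finset.sum_comm, Finset.sum_div]
    refine Finset.sum_congr rfl fun i _ => ?_
    rw [Finset.sum_comm, Finset.sum_div]
    exact Finset.sum_congr rfl fun k _ => by rw [← Finset.mul_sum, mul_div_assoc]
  · rw [Finset.sum_comm, Finset.sum_div]
    exact Finset.sum_congr rfl fun i _ => by rw [← Finset.mul_sum, mul_div_assoc]

theorem Approachable.meanMinObjective_le {v : ℝ} (h : Approachable net μ ℱ S v)
    (hS : IsIIDChannel μ ℱ ν S) (hΓ : IsDriftConstant net ν Γ) (hV : 0 ≤ V) {q : I → K → ℝ}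
    {p : I → ℝ} (hq : ∀ i k, 0 ≤ q i k) (hp : ∀ i, 0 ≤ p i) :
    meanMinObjective net ν V q p ≤ -(V * v) := by
  set W := V + ∑ i, ∑ k, q i k + ∑ i, p i with hW
  have hW0 : 0 ≤ W := add_nonneg (add_nonneg hV (Finset.sum_nonneg fun i _ =>
    Finset.sum_nonneg fun k _ => hq i k)) (Finset.sum_nonneg fun i _ => hp i)
  refine le_of_forall_pos_le_add fun ε hε => ?_
  -- `W` is the total weight of the three errors, so tolerance η costs Wη ≤ ε; the `+ 1` avoids
  -- division by zero.
  have hη : 0 < ε / (W + 1) := by positivity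
  obtain ⟨o, u, hpol, T, hT, h1, h2, h3⟩ := h _ hη
  generalize hη' : ε / (W + 1) = η at *
  have hε' : ε = η * (W + 1) := by rw [← hη']; field_simp
  have e1 : -V * timeAverage (expectedUtility net μ S o) T ≤ -V * (v - η) := by
    nlinarith
  have e2 : ∑ i, ∑ k, q i k * timeAverage (expectedDrift μ S o u i k) T ≤
      (∑ i, ∑ k, q i k) * η := by
    simp only [Finset.sum_mul]
    exact Finset.sum_le_sum fun i _ => Finset.sum_le_sum fun k _ =>
      mul_le_mul_of_nonneg_left (h2 i k) (hq i k)
  have e3 : ∑ i, p i * timeAverage (expectedDeficit net μ S o i) T ≤ (∑ i, p i) * η := by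
    simp only [Finset.sum_mul]
    exact Finset.sum_le_sum fun i _ => mul_le_mul_of_nonneg_left (h3 i) (hp i)
  refine (meanMinObjective_le_timeAverage hpol hS hΓ V hq p hT).trans ?_
  rw [hε', hW]
  linarith

end Policies

end SIN

end

/-! ### Greedy policies and the Lyapunov drift. -/

noncomputable section

namespace SIN

set_option linter.unusedSectionVars false

section Greedy

variable {I K N : Type*} [Fintype I] [Fintype K] [Fintype N] {net : Network I K N}
  {Ω : Type*} [mΩ : MeasurableSpace Ω] {μ : Measure Ω} {ℱ : Filtration ℕ mΩ}
  {ν : Measure (ChannelState I K N)} {S : ℕ → Ω → ChannelState I K N}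
  {o : ℕ → Ω → ObsDecision I K} {u : ℕ → Ω → TxDecision I K N} {P₀ : I → ℝ} {Γ V : ℝ}

/-- The queue lengths at the beginning of a slot together with the channel state. -/
def slotState (net : Network I K N) (P₀ : I → ℝ) (S : ℕ → Ω → ChannelState I K N)
    (o : ℕ → Ω → ObsDecision I K) (u : ℕ → Ω → TxDecision I K N) (t : ℕ) (ω : Ω) :
    SlotState I K N :=
  ((queue S o u t ω, virtualQueue net P₀ S o t ω), S t ω)

/-- The decisions minimize the slot objective in every slot. -/
def IsGreedy (net : Network I K N) (V : ℝ) (P₀ : I → ℝ) (S : ℕ → Ω → ChannelState I K N)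
    (o : ℕ → Ω → ObsDecision I K) (u : ℕ → Ω → TxDecision I K N) : Prop :=
  ∀ t ω, slotObjective net V (queue S o u t ω) (virtualQueue net P₀ S o t ω) (S t ω).1
    (o t ω) (u t ω) ≤ minObjective net V (slotState net P₀ S o u t ω)

theorem IsDMRC.isGreedy (h : IsDMRC net V P₀ S o u) : IsGreedy net V P₀ S o u := by
  intro t ω
  have hf := selector_feasible net V (slotState net P₀ S o u t ω)
  have h1 := (h.obs_opt t ω).2 hf.1
  have h2 := (h.tx_opt t ω).2 (hf.2 (S t ω).2)
  simp only [Set.mem_ofPred_eq] at h1 h2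
  rw [minObjective, slotObjective_eq, slotObjective_eq]
  simp only [slotState] at h1 h2 ⊢
  linarith

/-- Expected value of the Lyapunov function at the beginning of slot `t`. -/
def expectedLyapunov (net : Network I K N) (μ : Measure Ω) (P₀ : I → ℝ)
    (S : ℕ → Ω → ChannelState I K N) (o : ℕ → Ω → ObsDecision I K)
    (u : ℕ → Ω → TxDecision I K N) (t : ℕ) : ℝ :=
  ∫ ω, lyapunov (queue S o u t ω) (virtualQueue net P₀ S o t ω) ∂μ

theorem essBdd_lyapunov (hp : IsPolicy net ℱ S o u) (hS : IsIIDChannel μ ℱ ν S)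
    (hΓ : IsDriftConstant net ν Γ) (P₀ : I → ℝ) (t : ℕ) :
    EssBdd μ fun ω => lyapunov (queue S o u t ω) (virtualQueue net P₀ S o t ω) := by
  simp only [lyapunov, pow_two]
  have hq := essBdd_queue hp hS hΓ t
  have hv := essBdd_virtualQueue hp hS hΓ P₀ t
  exact .add (.const_mul _ (.sum _ fun i => .sum _ fun k => (hq i k).mul (hq i k)))
    (.const_mul _ (.sum _ fun i => (hv i).mul (hv i)))

theorem expectedLyapunov_nonneg (t : ℕ) : 0 ≤ expectedLyapunov net μ P₀ S o u t :=
  integral_nonneg fun _ => lyapunov_nonneg _ _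

variable [IsProbabilityMeasure μ]

theorem measurable_pair {X : Type*} {mX : MeasurableSpace X} {q : X → I → K → ℝ}
    {p : X → I → ℝ} (hq : ∀ i k, Measurable fun x => q x i k)
    (hp : ∀ i, Measurable fun x => p x i) : Measurable fun x => (q x, p x) :=
  (measurable_pi_iff.2 fun i => measurable_pi_iff.2 fun k => hq i k).prodMk
    (measurable_pi_iff.2 hp)

theorem indepFun_queues (hp : IsPolicy net ℱ S o u) (hS : IsIIDChannel μ ℱ ν S) (P₀ : I → ℝ)
    (t : ℕ) :
    IndepFun (fun ω => (queue S o u t ω, virtualQueue net P₀ S o t ω)) (S t) μ := by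
  have h : Measurable[ℱ t] fun ω => (queue S o u t ω, virtualQueue net P₀ S o t ω) :=
    measurable_pair (measurable_queue hp hS t) (measurable_virtualQueue hp hS P₀ t)
  rw [IndepFun_iff_Indep]
  exact indep_of_indep_of_le_left (hS.indep t) (measurable_iff_comap_le.1 h)

/-- Fubini for the product law of queues and channel state. The bound `hc` is used later with (c, δ)
= (-Vv, 0) for utility and (0, δ) for backlog. -/
theorem integral_slotObjective_le_of_isGreedy (hp : IsPolicy net ℱ S o u)
    (hS : IsIIDChannel μ ℱ ν S) (hΓ : IsDriftConstant net ν Γ) (hP₀ : ∀ i, 0 ≤ P₀ i)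
    (hg : IsGreedy net V P₀ S o u) {c δ : ℝ}
    (hc : ∀ q p, (∀ i k, 0 ≤ q i k) → (∀ i, 0 ≤ p i) →
      meanMinObjective net ν V q p ≤ c - δ * ∑ i, ∑ k, q i k) (t : ℕ) :
    ∫ ω, slotObjective net V (queue S o u t ω) (virtualQueue net P₀ S o t ω) (S t ω).1
      (o t ω) (u t ω) ∂μ ≤ c - δ * expectedBacklog μ S o u t := by
  have := hS.isProbabilityMeasure
  have hslot := hp.isSlotDecision hS t
  have hgbd := hslot.essBdd_slotObjective hΓ (hS.law t) V (essBdd_queue hp hS hΓ t)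
    (essBdd_virtualQueue hp hS hΓ P₀ t)
  -- A feasible decision cannot beat the minimum, so greediness is an equality.
  have heq : (fun ω => slotObjective net V (queue S o u t ω) (virtualQueue net P₀ S o t ω)
      (S t ω).1 (o t ω) (u t ω)) =
      fun ω => minObjective net V (slotState net P₀ S o u t ω) := funext fun ω =>
    (hg t ω).antisymm (minObjective_le (z := slotState net P₀ S o u t ω) V
      (queue_nonneg hp t ω) (hp.obsFeasible t ω) (hp.txFeasible t ω))
  rw [heq] at hgbd ⊢
  set X : Ω → (I → K → ℝ) × (I → ℝ) :=
    fun ω => (queue S o u t ω, virtualQueue net P₀ S o t ω) with hX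
  have hXm : Measurable X :=
    measurable_pair (fun i k => (essBdd_queue hp hS hΓ t i k).measurable)
      fun i => (essBdd_virtualQueue hp hS hΓ P₀ t i).measurable
  have hSm := hslot.measurable_state
  have hpair : Measurable fun ω => (X ω, S t ω) := hXm.prodMk hSm
  have hmap : μ.map (fun ω => (X ω, S t ω)) = (μ.map X).prod ν := by
    rw [(indepFun_iff_map_prod_eq_prod_map_map hXm.aemeasurable hSm.aemeasurable).1
      (indepFun_queues hp hS P₀ t), hS.law t]
  have hmeas := measurable_minObjective net V
  have hint : Integrable (minObjective net V) ((μ.map X).prod ν) := by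
    rw [← hmap, integrable_map_measure hmeas.aestronglyMeasurable hpair.aemeasurable]
    exact hgbd.integrable
  have : IsProbabilityMeasure (μ.map X) := Measure.isProbabilityMeasure_map hXm.aemeasurable
  have hinner := hint.integral_prod_left
  have h1 : ∫ ω, minObjective net V (slotState net P₀ S o u t ω) ∂μ =
      ∫ ω, meanMinObjective net ν V (X ω).1 (X ω).2 ∂μ := by
    calc ∫ ω, minObjective net V (slotState net P₀ S o u t ω) ∂μ
        = ∫ z, minObjective net V z ∂(μ.map fun ω => (X ω, S t ω)) :=
          (integral_map hpair.aemeasurable hmeas.aestronglyMeasurable).symm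
      _ = ∫ x, ∫ s, minObjective net V (x, s) ∂ν ∂(μ.map X) := by
          rw [hmap, integral_prod _ hint]
      _ = _ := integral_map hXm.aemeasurable hinner.aestronglyMeasurable
  have hsum := EssBdd.sum Finset.univ fun i => EssBdd.sum Finset.univ fun k =>
    essBdd_queue hp hS hΓ t i k
  have h2 : c - δ * expectedBacklog μ S o u t =
      ∫ ω, (c - δ * ∑ i, ∑ k, queue S o u t ω i k) ∂μ := by
    rw [integral_sub (integrable_const _) (hsum.const_mul δ).integrable, integral_const_mul,
      integral_finsetSum _ fun i _ =>
        (EssBdd.sum Finset.univ fun k => essBdd_queue hp hS hΓ t i k).integrable]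
    simp only [integral_const, probReal_univ, one_smul, expectedBacklog]
    congr 2
    refine Finset.sum_congr rfl fun i _ => ?_
    rw [integral_finsetSum _ fun k _ => (essBdd_queue hp hS hΓ t i k).integrable]
  rw [h1, h2]
  refine integral_mono ((integrable_map_measure hinner.aestronglyMeasurable
    hXm.aemeasurable).1 hinner) ((EssBdd.const c).sub (hsum.const_mul δ)).integrable fun ω => ?_
  exact hc _ _ (queue_nonneg hp t ω) (virtualQueue_nonneg hP₀ t ω)

theorem expectedLyapunov_succ_le (hp : IsPolicy net ℱ S o u)
    (hS : IsIIDChannel μ ℱ ν S) (hΓ : IsDriftConstant net ν Γ) (hP₀ : ∀ i, 0 ≤ P₀ i)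
    (hg : IsGreedy net V P₀ S o u) {c δ : ℝ}
    (hc : ∀ q p, (∀ i k, 0 ≤ q i k) → (∀ i, 0 ≤ p i) →
      meanMinObjective net ν V q p ≤ c - δ * ∑ i, ∑ k, q i k) (t : ℕ) :
    expectedLyapunov net μ P₀ S o u (t + 1) ≤ expectedLyapunov net μ P₀ S o u t +
      (Γ + c + V * expectedUtility net μ S o t - δ * expectedBacklog μ S o u t) := by
  have hslot := hp.isSlotDecision hS t
  have hL := essBdd_lyapunov hp hS hΓ P₀ t
  have hG := hslot.essBdd_slotObjective hΓ (hS.law t) V (essBdd_queue hp hS hΓ t)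
    (essBdd_virtualQueue hp hS hΓ P₀ t)
  have hU := EssBdd.sum Finset.univ fun i => hslot.essBdd_utility hΓ (hS.law t) i
  have hUi : ∫ ω, ∑ i, net.U i (flowRate (S t ω).1 (o t ω) i) ∂μ =
      expectedUtility net μ S o t :=
    integral_finsetSum _ fun i _ => (hslot.essBdd_utility hΓ (hS.law t) i).integrable
  have hle := integral_slotObjective_le_of_isGreedy hp hS hΓ hP₀ hg hc t
  have hLG := hL.add (EssBdd.const Γ)
  have hVU := hU.const_mul V
  have key : expectedLyapunov net μ P₀ S o u (t + 1) ≤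
      ∫ ω, (lyapunov (queue S o u t ω) (virtualQueue net P₀ S o t ω) + Γ
        + slotObjective net V (queue S o u t ω) (virtualQueue net P₀ S o t ω) (S t ω).1
          (o t ω) (u t ω)
        + V * ∑ i, net.U i (flowRate (S t ω).1 (o t ω) i)) ∂μ := by
    refine integral_mono_ae (essBdd_lyapunov hp hS hΓ P₀ (t + 1)).integrable
      ((hLG.add hG).add hVU).integrable ?_
    filter_upwards [hslot.ae_drift_le hΓ (hS.law t)] with ω hω
    have h := lyapunov_step_le (p := virtualQueue net P₀ S o t ω)
      (b := fun i => net.a i - flowRate (S t ω).1 (o t ω) i) (queue_nonneg hp t ω)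
      (arrival_nonneg (hp.obsFeasible t ω) (S t ω).1) (service_nonneg (hp.txFeasible t ω))
    refine h.trans ?_
    rw [slotObjective]
    linarith
  rw [integral_add (hLG.add hG).integrable hVU.integrable,
    integral_add hLG.integrable hG.integrable,
    integral_add hL.integrable (integrable_const _), integral_const_mul, hUi] at key
  simp only [integral_const, probReal_univ, one_smul] at key
  rw [expectedLyapunov] at key ⊢
  rw [expectedLyapunov]
  linarith

theorem expectedLyapunov_le (hp : IsPolicy net ℱ S o u)
    (hS : IsIIDChannel μ ℱ ν S) (hΓ : IsDriftConstant net ν Γ) (hP₀ : ∀ i, 0 ≤ P₀ i)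
    (hg : IsGreedy net V P₀ S o u) {c δ : ℝ}
    (hc : ∀ q p, (∀ i k, 0 ≤ q i k) → (∀ i, 0 ≤ p i) →
      meanMinObjective net ν V q p ≤ c - δ * ∑ i, ∑ k, q i k) {T : ℕ} (hT : 0 < T) :
    expectedLyapunov net μ P₀ S o u T ≤ expectedLyapunov net μ P₀ S o u 0 +
      T * (Γ + c + V * timeAverage (expectedUtility net μ S o) T
        - δ * timeAverage (expectedBacklog μ S o u) T) := by
  have h : ∀ T : ℕ, expectedLyapunov net μ P₀ S o u T ≤ expectedLyapunov net μ P₀ S o u 0 +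
      (T * (Γ + c) + V * ∑ t ∈ Finset.range T, expectedUtility net μ S o t
        - δ * ∑ t ∈ Finset.range T, expectedBacklog μ S o u t) := by
    intro T
    induction T with
    | zero => simp
    | succ T ih =>
      have := expectedLyapunov_succ_le hp hS hΓ hP₀ hg hc T
      rw [Finset.sum_range_succ, Finset.sum_range_succ]
      push_cast
      linarith
  have hT' : (T : ℝ) ≠ 0 := by positivity
  refine (h T).trans_eq ?_
  simp only [timeAverage]
  field_simp

theorem le_timeAverage_utility_of_isGreedy (hp : IsPolicy net ℱ S o u)
    (hS : IsIIDChannel μ ℱ ν S) (hΓ : IsDriftConstant net ν Γ) (hP₀ : ∀ i, 0 ≤ P₀ i)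
    (hV : 0 < V) (hg : IsGreedy net V P₀ S o u) {v : ℝ} (hv : Approachable net μ ℱ S v) {T : ℕ}
    (hT : 0 < T) :
    v - Γ / V - expectedLyapunov net μ P₀ S o u 0 / V / T ≤
      timeAverage (expectedUtility net μ S o) T := by
  have hT' : (0 : ℝ) < T := by exact_mod_cast hT
  have h := expectedLyapunov_le hp hS hΓ hP₀ hg (c := -(V * v)) (δ := 0)
    (fun q p hq hp => by simpa using hv.meanMinObjective_le hS hΓ hV.le hq hp) hT
  have h0 := expectedLyapunov_nonneg (net := net) (μ := μ) (P₀ := P₀) (S := S) (o := o) (u := u) T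
  generalize timeAverage (expectedUtility net μ S o) T = a at *
  generalize expectedLyapunov net μ P₀ S o u 0 = L at *
  have h1 : v - Γ / V - L / V / T = (T * (V * v - Γ) - L) / (V * T) := by
    field_simp
  rw [h1, div_le_iff₀ (by positivity)]
  linarith

theorem tendsto_const_div_natCast (c : ℝ) : Tendsto (fun T : ℕ => c / (T : ℝ)) atTop (𝓝 0) :=
  tendsto_const_nhds.div_atTop tendsto_natCast_atTop_atTop

theorem le_liminf_utility_of_isGreedy (hp : IsPolicy net ℱ S o u)
    (hS : IsIIDChannel μ ℱ ν S) (hΓ : IsDriftConstant net ν Γ) (hP₀ : ∀ i, 0 ≤ P₀ i)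
    (hV : 0 < V) (hg : IsGreedy net V P₀ S o u) {v : ℝ} (hv : Approachable net μ ℱ S v) :
    ((v - Γ / V : ℝ) : EReal) ≤
      liminf (fun T => ((timeAverage (expectedUtility net μ S o) T : ℝ) : EReal)) atTop := by
  refine le_liminf_coe fun ε hε => ?_
  filter_upwards [(tendsto_const_div_natCast
    (expectedLyapunov net μ P₀ S o u 0 / V)).eventually_lt_const hε, eventually_gt_atTop 0]
    with T h1 h2
  linarith [le_timeAverage_utility_of_isGreedy hp hS hΓ hP₀ hV hg hv h2]

/-- With s = √T one has f s ≤ f² + s² ≤ 2L + s². Integrating and dividing by s gives E f ≤ (2D + 1)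
√T. -/
theorem integral_div_le_of_sq_le {f L : Ω → ℝ} (hf : Integrable f μ) (hL : Integrable L μ)
    (h : ∀ ω, f ω ^ 2 ≤ 2 * L ω) {D : ℝ} {T : ℕ} (hT : 0 < T) (hD : ∫ ω, L ω ∂μ ≤ D * T) :
    (∫ ω, f ω ∂μ) / T ≤ (2 * D + 1) / √T := by
  have hT' : (0 : ℝ) < T := by exact_mod_cast hT
  have hs := Real.sqrt_pos.2 hT'
  have hsq := Real.mul_self_sqrt hT'.le
  generalize √(T : ℝ) = s at *
  have h1 : ∫ ω, f ω ∂μ ≤ ∫ ω, (2 / s * L ω + s) ∂μ := by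
    refine integral_mono hf ((hL.const_mul _).add (integrable_const s)) fun ω => ?_
    have h2 : f ω * s ≤ 2 * L ω + s * s := by
      nlinarith [h ω, sq_nonneg (f ω - s), sq_nonneg (f ω), sq_nonneg s]
    have h3 : 2 / s * L ω + s = (2 * L ω + s * s) / s := by field_simp
    simp only [h3]
    rwa [le_div_iff₀ hs]
  rw [integral_add (hL.const_mul _) (integrable_const s), integral_const_mul] at h1
  simp only [integral_const, probReal_univ, one_smul] at h1
  have h4 : 2 / s * ∫ ω, L ω ∂μ ≤ 2 / s * (D * T) :=
    mul_le_mul_of_nonneg_left hD (by positivity)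
  rw [div_le_iff₀ hT']
  refine h1.trans ((add_le_add_left h4 s).trans_eq ?_)
  rw [← hsq]
  field_simp

theorem sq_queue_le (q : I → K → ℝ) (p : I → ℝ) (i : I) (k : K) :
    q i k ^ 2 ≤ 2 * lyapunov q p := by
  have h1 := Finset.single_le_sum (f := fun i => ∑ k, q i k ^ 2)
    (fun i _ => by positivity) (Finset.mem_univ i)
  have h2 := Finset.single_le_sum (f := fun k => q i k ^ 2)
    (fun i _ => by positivity) (Finset.mem_univ k)
  have h3 : 0 ≤ ∑ i, p i ^ 2 := by positivity
  unfold lyapunov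
  linarith

theorem sq_virtualQueue_le (q : I → K → ℝ) (p : I → ℝ) (i : I) :
    p i ^ 2 ≤ 2 * lyapunov q p := by
  have h1 := Finset.single_le_sum (f := fun i => p i ^ 2)
    (fun i _ => by positivity) (Finset.mem_univ i)
  have h3 : 0 ≤ ∑ i, ∑ k, q i k ^ 2 := by positivity
  unfold lyapunov
  linarith

theorem longTermFeasible_of_isGreedy (hp : IsPolicy net ℱ S o u)
    (hS : IsIIDChannel μ ℱ ν S) (hΓ : IsDriftConstant net ν Γ) (hP₀ : ∀ i, 0 ≤ P₀ i)
    (hV : 0 < V) (hg : IsGreedy net V P₀ S o u) {v : ℝ} (hv : Approachable net μ ℱ S v) :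
    LongTermFeasible net μ S o u := by
  obtain ⟨D, hD⟩ : ∃ D : ℝ, ∀ T : ℕ, 0 < T → expectedLyapunov net μ P₀ S o u T ≤ D * T := by
    -- The initial value is absorbed into the linear rate because T ≥ 1.
    refine ⟨expectedLyapunov net μ P₀ S o u 0 + (Γ + -(V * v) +
      V * ∑ i, net.U i (|net.a i| + √(2 * Γ))), fun T hT => ?_⟩
    have h := expectedLyapunov_le hp hS hΓ hP₀ hg (c := -(V * v)) (δ := 0)
      (fun q p hq hp => by simpa using hv.meanMinObjective_le hS hΓ hV.le hq hp) hT
    have hT' : (1 : ℝ) ≤ T := by exact_mod_cast hT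
    have h1 := mul_le_mul_of_nonneg_left (timeAverage_le (expectedUtility_le hp hS hΓ) hT) hV.le
    have h0 := expectedLyapunov_nonneg (net := net) (μ := μ) (P₀ := P₀) (S := S) (o := o)
      (u := u) 0
    nlinarith
  have hlim : Tendsto (fun T : ℕ => (2 * D + 1) / √(T : ℝ)) atTop (𝓝 0) :=
    tendsto_const_nhds.div_atTop (Real.tendsto_sqrt_atTop.comp tendsto_natCast_atTop_atTop)
  have hL := fun T => (essBdd_lyapunov hp hS hΓ P₀ T).integrable
  refine ⟨fun i k => ?_, fun i => le_liminf_coe fun ε hε => ?_⟩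
  · refine squeeze_zero' (.of_forall fun T => by positivity) ?_ hlim
    filter_upwards [eventually_gt_atTop 0] with T hT
    simp only [abs_of_nonneg (queue_nonneg hp _ _ i k)]
    exact integral_div_le_of_sq_le (essBdd_queue hp hS hΓ T i k).integrable (hL T)
      (fun ω => sq_queue_le _ _ i k) hT (hD T hT)
  · filter_upwards [hlim.eventually_lt_const hε, eventually_gt_atTop 0] with T h1 hT
    have h2 := timeAverage_deficit_le hp hS hΓ hP₀ i T
    rw [timeAverage_deficit hp hS hΓ i hT] at h2
    have h3 := integral_div_le_of_sq_le (essBdd_virtualQueue hp hS hΓ P₀ T i).integrable (hL T)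
      (fun ω => sq_virtualQueue_le _ _ i) hT (hD T hT)
    linarith

/-! ### Existence of a greedy policy. -/

/-- One step of the queue dynamics when the decisions are made by the selector. -/
def greedyStep (net : Network I K N) (V : ℝ) (z : SlotState I K N) : (I → K → ℝ) × (I → ℝ) :=
  (fun i k => max 0 (z.1.1 i k - service ((selector net V z).tx z.2.2) i k)
      + arrival z.2.1 (selector net V z).obs i k,
    fun i => max 0 (z.1.2 i + (net.a i - flowRate z.2.1 (selector net V z).obs i)))

theorem measurable_greedyStep (net : Network I K N) (V : ℝ) : Measurable (greedyStep net V) := by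
  have h := isSlotDecision_selector net V (measurable_id (α := SlotState I K N))
  have hq : Measurable fun z : SlotState I K N => z.1.1 := measurable_fst.fst
  have hp : Measurable fun z : SlotState I K N => z.1.2 := measurable_fst.snd
  exact measurable_pair (fun i k => (measurable_const.max
      ((measurable_pi_iff.1 (measurable_pi_iff.1 hq i) k).sub (h.measurable_service i k))).add
        (h.measurable_arrival i k))
    fun i => measurable_const.max ((measurable_pi_iff.1 hp i).add
      (measurable_const.sub (h.measurable_flowRate i)))

/-- The queue lengths when the decisions are made by the selector. -/
def greedyQueues (net : Network I K N) (V : ℝ) (P₀ : I → ℝ) (S : ℕ → Ω → ChannelState I K N) :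
    ℕ → Ω → (I → K → ℝ) × (I → ℝ)
  | 0, _ => (fun _ _ => 0, P₀)
  | t + 1, ω => greedyStep net V (greedyQueues net V P₀ S t ω, S t ω)

theorem measurable_greedyQueues (hS : IsIIDChannel μ ℱ ν S) (V : ℝ) (P₀ : I → ℝ) (t : ℕ) :
    Measurable[ℱ t] (greedyQueues net V P₀ S t) := by
  induction t with
  | zero => exact measurable_const
  | succ t ih =>
    exact (measurable_greedyStep net V).comp
      ((ih.mono (ℱ.mono t.le_succ) le_rfl).prodMk (hS.measurable t))

/-- Decisions depend on queues that depend on earlier decisions. Building the queues first by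
recursion breaks the circle; induction then identifies them with the queues of the resulting policy.
-/
theorem exists_isGreedy (net : Network I K N) (hS : IsIIDChannel μ ℱ ν S) (V : ℝ) (P₀ : I → ℝ) :
    ∃ o u, IsPolicy net ℱ S o u ∧ IsGreedy net V P₀ S o u := by
  let z : ℕ → Ω → SlotState I K N := fun t ω => (greedyQueues net V P₀ S t ω, S t ω)
  let o : ℕ → Ω → ObsDecision I K := fun t ω => (selector net V (z t ω)).obs
  let u : ℕ → Ω → TxDecision I K N := fun t ω => (selector net V (z t ω)).tx (z t ω).2.2
  have hzm : ∀ t, Measurable[ℱ (t + 1)] (z t) := fun t =>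
    ((measurable_greedyQueues (net := net) hS V P₀ t).mono (ℱ.mono t.le_succ) le_rfl).prodMk
      (hS.measurable t)
  have h := isSlotDecision_selector net V (measurable_id (α := SlotState I K N))
  have hz : ∀ t ω, slotState net P₀ S o u t ω = z t ω := by
    intro t ω
    have h1 : (queue S o u t ω, virtualQueue net P₀ S o t ω) = greedyQueues net V P₀ S t ω := by
      induction t with
      | zero => rfl
      | succ t ih =>
        have e1 : queue S o u t ω = (z t ω).1.1 := congrArg Prod.fst ih
        have e2 : virtualQueue net P₀ S o t ω = (z t ω).1.2 := congrArg Prod.snd ih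
        refine Prod.ext ?_ ?_
        · funext i k
          simp only [queue, e1]
          rfl
        · funext i
          simp only [virtualQueue, e2]
          rfl
    exact Prod.ext h1 rfl
  refine ⟨o, u, ⟨fun t i k => (h.measurable_x i k).comp (hzm t),
    fun t i k => (h.measurable_ρ i k).comp (hzm t), fun t k n => (h.measurable_y k n).comp (hzm t),
    fun t k n i => (h.measurable_w k n i).comp (hzm t), fun t ω => h.obsFeasible (z t ω),
    fun t ω => h.txFeasible (z t ω)⟩, fun t ω => ?_⟩
  have h1 := hz t ω
  have e1 : queue S o u t ω = (z t ω).1.1 := congrArg (fun y => y.1.1) h1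
  have e2 : virtualQueue net P₀ S o t ω = (z t ω).1.2 := congrArg (fun y => y.1.2) h1
  rw [h1, e1, e2]
  exact le_rfl

/-! ### Comparison with the optimal utility and the backlog bound. -/

theorem approachable_of_mem (hS : IsIIDChannel μ ℱ ν S)
    (hΓ : IsDriftConstant net ν Γ) {v : ℝ} (hv : v ∈ achievableUtilities net μ ℱ S) :
    Approachable net μ ℱ S v := by
  obtain ⟨o, u, hp, hl, hv⟩ := hv
  intro ε hε
  obtain ⟨T, h1, ⟨h2, h3⟩, hT⟩ := ((eventually_sub_le_of_le_liminf hv hε).and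
    ((hl.eventually_le hp hS hΓ hε).and (eventually_gt_atTop 0))).exists
  exact ⟨o, u, hp, T, hT, h1, h2, h3⟩

theorem approachable_optimalUtility (hS : IsIIDChannel μ ℱ ν S)
    (hΓ : IsDriftConstant net ν Γ) (hne : (achievableUtilities net μ ℱ S).Nonempty) :
    Approachable net μ ℱ S (optimalUtility net μ ℱ S) := by
  intro ε hε
  obtain ⟨v, hv, hlt⟩ := exists_lt_of_lt_csSup hne
    (show optimalUtility net μ ℱ S - ε / 2 < sSup _ from sub_lt_self _ (half_pos hε))
  obtain ⟨o, u, hp, T, hT, h1, h2, h3⟩ := approachable_of_mem hS hΓ hv (ε / 2) (half_pos hε)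
  exact ⟨o, u, hp, T, hT, by linarith, fun i k => (h2 i k).trans (by linarith),
    fun i => (h3 i).trans (by linarith)⟩

/-- A greedy policy turns finite-horizon performance into a long-term feasible policy that loses
only Γ/V. Since U* does not involve the initial virtual queues, they are started at 0. -/
theorem Approachable.le_optimalUtility {v : ℝ} (h : Approachable net μ ℱ S v)
    (hS : IsIIDChannel μ ℱ ν S) (hΓ : IsDriftConstant net ν Γ) :
    v ≤ optimalUtility net μ ℱ S := by
  have key : ∀ V : ℝ, 0 < V → v - Γ / V ≤ optimalUtility net μ ℱ S := fun V hV => by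
    obtain ⟨o, u, hp, hg⟩ := exists_isGreedy net hS V (0 : I → ℝ)
    exact le_csSup (bddAbove_achievableUtilities hS hΓ)
      ⟨o, u, hp, longTermFeasible_of_isGreedy hp hS hΓ (fun _ => le_rfl) hV hg h,
        le_liminf_utility_of_isGreedy hp hS hΓ (fun _ => le_rfl) hV hg h⟩
  have hlim : Tendsto (fun V : ℝ => v - Γ / V) atTop (𝓝 (v - 0)) :=
    tendsto_const_nhds.sub (tendsto_const_nhds.div_atTop tendsto_id)
  rw [sub_zero] at hlim
  refine le_of_tendsto hlim ?_
  filter_upwards [eventually_gt_atTop 0] with V hV using key V hV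

/-- If the average exceeded U* + ε infinitely often, U* + ε would be approachable, hence at most U*.
-/
theorem eventually_timeAverage_utility_le (hp : IsPolicy net ℱ S o u)
    (hS : IsIIDChannel μ ℱ ν S) (hΓ : IsDriftConstant net ν Γ) (hl : LongTermFeasible net μ S o u)
    {ε : ℝ} (hε : 0 < ε) :
    ∀ᶠ T in atTop, timeAverage (expectedUtility net μ S o) T ≤
      optimalUtility net μ ℱ S + ε := by
  by_contra hcon
  rw [not_eventually] at hcon
  have h := (hl.approachable hp hS hΓ (hcon.mono fun T hT => (not_le.1 hT).le)).le_optimalUtility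
    hS hΓ
  linarith

theorem meanMinObjective_le_of_hasSlack [IsProbabilityMeasure ν] (hΓ : IsDriftConstant net ν Γ)
    {δ : ℝ} (hδ : HasSlack net ν δ) (hV : 0 ≤ V) {q : I → K → ℝ} {p : I → ℝ}
    (hq : ∀ i k, 0 ≤ q i k) (hp : ∀ i, 0 ≤ p i) :
    meanMinObjective net ν V q p ≤ 0 - δ * ∑ i, ∑ k, q i k := by
  obtain ⟨π, h1, h2⟩ := hδ
  have := π.isProbabilityMeasure_seed
  have hslot : IsSlotDecision net Prod.snd π.obs π.tx :=
    ⟨measurable_snd, π.measurable_x, π.measurable_ρ, π.measurable_y, π.measurable_w,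
      π.obsFeasible, π.txFeasible⟩
  have hlaw : (π.seed.prod ν).map Prod.snd = ν := by simp
  refine (meanMinObjective_le hΓ hslot hlaw V hq p).trans ?_
  have e1 : 0 ≤ V * ∑ i, ∫ z, net.U i (flowRate z.2.1 (π.obs z) i) ∂(π.seed.prod ν) :=
    mul_nonneg hV (Finset.sum_nonneg fun i _ => integral_nonneg fun z =>
      (net.isUtility i).nonneg_of_nonneg (flowRate_nonneg (π.obsFeasible z) _ i))
  have e2 : ∑ i, ∑ k, q i k *
      ∫ z, (arrival z.2.1 (π.obs z) i k - service (π.tx z) i k) ∂(π.seed.prod ν) ≤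
      -(δ * ∑ i, ∑ k, q i k) := by
    rw [← neg_mul, mul_comm]
    simp only [Finset.sum_mul]
    exact Finset.sum_le_sum fun i _ => Finset.sum_le_sum fun k _ =>
      mul_le_mul_of_nonneg_left (h1 i k) (hq i k)
  have e3 : ∑ i, p i * ∫ z, (net.a i - flowRate z.2.1 (π.obs z) i) ∂(π.seed.prod ν) ≤ 0 :=
    Finset.sum_nonpos fun i _ => mul_nonpos_of_nonneg_of_nonpos (hp i) (h2 i)
  linarith

theorem limsup_backlog_le_of_isGreedy (hp : IsPolicy net ℱ S o u)
    (hS : IsIIDChannel μ ℱ ν S) (hΓ : IsDriftConstant net ν Γ) (hP₀ : ∀ i, 0 ≤ P₀ i)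
    (hV : 0 < V) (hg : IsGreedy net V P₀ S o u)
    (hne : (achievableUtilities net μ ℱ S).Nonempty) {δ : ℝ} (hδ : 0 < δ)
    (hslack : HasSlack net ν δ) :
    limsup (fun T => ((timeAverage (expectedBacklog μ S o u) T : ℝ) : EReal)) atTop
      ≤ (((Γ + V * optimalUtility net μ ℱ S) / δ : ℝ) : EReal) := by
  have := hS.isProbabilityMeasure
  have hl := longTermFeasible_of_isGreedy hp hS hΓ hP₀ hV hg
    (approachable_optimalUtility hS hΓ hne)
  refine limsup_coe_le fun ε hε => ?_
  -- The tolerance εδ is split in halves: one for V times the utility excess, one for the initial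
  -- Lyapunov value divided by T.
  filter_upwards [eventually_timeAverage_utility_le hp hS hΓ hl
      (show 0 < ε * δ / 2 / V by positivity),
    (tendsto_const_div_natCast (expectedLyapunov net μ P₀ S o u 0)).eventually_lt_const
      (show 0 < ε * δ / 2 by positivity), eventually_gt_atTop 0] with T h1 h2 hT
  have hT' : (0 : ℝ) < T := by exact_mod_cast hT
  have h := expectedLyapunov_le hp hS hΓ hP₀ hg (c := 0) (δ := δ)
    (fun q p hq hp => meanMinObjective_le_of_hasSlack hΓ hslack hV.le hq hp) hT
  have h0 := (expectedLyapunov_nonneg (net := net) (μ := μ) (P₀ := P₀) (S := S) (o := o)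
    (u := u) T).trans h
  have h3 := mul_le_mul_of_nonneg_left h1 hV.le
  rw [mul_add, mul_div_cancel₀ _ hV.ne'] at h3
  rw [div_lt_iff₀ hT'] at h2
  have h4 : 0 < T * (ε * δ / 2 + (Γ + 0 + V * timeAverage (expectedUtility net μ S o) T
      - δ * timeAverage (expectedBacklog μ S o u) T)) := by linarith
  have h5 := (mul_pos_iff_of_pos_left hT').1 h4
  have h6 : (Γ + V * optimalUtility net μ ℱ S) / δ + ε =
      (Γ + V * optimalUtility net μ ℱ S + ε * δ) / δ := by field_simp
  rw [h6, le_div_iff₀ hδ]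
  linarith

end Greedy

end SIN

end

theorem mainTheorem1 {I K N : Type*} [Fintype I] [Fintype K] [Fintype N]
    (net : SIN.Network I K N)
    {Ω : Type*} [mΩ : MeasurableSpace Ω] (μ : Measure Ω) [IsProbabilityMeasure μ]
    (ℱ : Filtration ℕ mΩ)
    (ν : Measure (SIN.ChannelState I K N)) (S : ℕ → Ω → SIN.ChannelState I K N)
    (hS : SIN.IsIIDChannel μ ℱ ν S)
    (Γ : ℝ) (hΓ : SIN.IsDriftConstant net ν Γ)
    (P₀ : I → ℝ) (hP₀ : ∀ i, 0 ≤ P₀ i)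
    (hfeas : (SIN.achievableUtilities net μ ℱ S).Nonempty) :
    BddAbove (SIN.achievableUtilities net μ ℱ S) ∧
    (∀ V : ℝ, 0 < V → ∀ (o : ℕ → Ω → SIN.ObsDecision I K) (u : ℕ → Ω → SIN.TxDecision I K N),
      SIN.IsPolicy net ℱ S o u → SIN.IsDMRC net V P₀ S o u →
      (∀ t i k, Integrable (fun ω => SIN.queue S o u t ω i k) μ) ∧
      (∀ t i, Integrable (fun ω => net.U i (SIN.flowRate (S t ω).1 (o t ω) i)) μ) ∧
      (∀ δ₁ : ℝ, 0 < δ₁ → SIN.HasSlack net ν δ₁ →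
        limsup (fun T => ((SIN.timeAverage (SIN.expectedBacklog μ S o u) T : ℝ) : EReal)) atTop
          ≤ (((Γ + V * SIN.optimalUtility net μ ℱ S) / δ₁ : ℝ) : EReal)) ∧
      ((SIN.optimalUtility net μ ℱ S - Γ / V : ℝ) : EReal) ≤
        liminf (fun T => ((SIN.timeAverage (SIN.expectedUtility net μ S o) T : ℝ) : EReal))
          atTop) ∧
    (∀ ε : ℝ, 0 < ε → ∃ V₀ : ℝ, 0 < V₀ ∧ ∀ V : ℝ, V₀ ≤ V →
      ∀ (o : ℕ → Ω → SIN.ObsDecision I K) (u : ℕ → Ω → SIN.TxDecision I K N),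
      SIN.IsPolicy net ℱ S o u → SIN.IsDMRC net V P₀ S o u →
      ((SIN.optimalUtility net μ ℱ S - ε : ℝ) : EReal) ≤
        liminf (fun T => ((SIN.timeAverage (SIN.expectedUtility net μ S o) T : ℝ) : EReal))
          atTop) := by

  have hopt := SIN.approachable_optimalUtility hS hΓ hfeas
  refine ⟨SIN.bddAbove_achievableUtilities hS hΓ, fun V hV o u hp hd => ⟨fun t i k =>
    (SIN.essBdd_queue hp hS hΓ t i k).integrable, fun t i =>
    ((hp.isSlotDecision hS t).essBdd_utility hΓ (hS.law t) i).integrable, fun δ hδ hslack =>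
    SIN.limsup_backlog_le_of_isGreedy hp hS hΓ hP₀ hV hd.isGreedy hfeas hδ hslack,
    SIN.le_liminf_utility_of_isGreedy hp hS hΓ hP₀ hV hd.isGreedy hopt⟩, fun ε hε => ?_⟩
  -- Any V₀ ≥ Γ/ε works; the absolute value and the `+ 1` only ensure V₀ > 0.
  refine ⟨(|Γ| + 1) / ε, by positivity, fun V hV o u hp hd => ?_⟩
  have hV0 : 0 < V := lt_of_lt_of_le (by positivity) hV
  refine le_trans (EReal.coe_le_coe_iff.2 ?_)
    (SIN.le_liminf_utility_of_isGreedy hp hS hΓ hP₀ hV0 hd.isGreedy hopt)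
  have h1 : Γ / V ≤ ε := by
    rw [div_le_iff₀ hε] at hV
    rw [div_le_iff₀ hV0]
    linarith [le_abs_self Γ]
  linarith
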